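/- Let $\mathbb{G}$ be a simple graph with $n\ge 3$ vertices and $m$ edges, labelled and oriented. For $x=(x_1,\dots,x_n)\in\mathbb{R}^{2n}$ let $z=\bar Hx$ have the components $z_k=x_i-x_j\in\mathbb{R}^2$, where $i$ is the head and $j$ the tail of edge $k$ (so $\bar H=H\otimes I_2$ with $H$ the transposed incidence matrix). Given target distances $d_1,\dots,d_m>0$, put $e_k(z)=\|z_k\|^2-d_k^2$, $D(z)=\operatorname{diag}\{z_1,\dots,z_m\}$, $R(z)=D(z)'\bar H$, $S(z)=D(z)'\bar J$, where $\bar J$ results from $-\bar H$ by replacing its negative entries by zeros. The overall system with mismatch error $\mu\in\mathbb{R}^m$ is $$\dot x=-R(z)'e(z)+S(z)'\mu,\qquad z=\bar Hx .$$ For a set $T$ of edges let $\tilde P$ and $\widehat P$ be the matrices selecting the entries of a vector in $\mathbb{R}^m$ with labels in $T$ and outside $T$, respectively, and $\tilde R=\tilde PR$. The framework at $x$ with edge set $T$ is infinitesimally rigid if $\operatorname{rank}\tilde R(\bar Hx)=2n-3$, and minimally so if in addition this fails after the removal of any edge of $T$. Let $\{\mathbb{G},y\}$ be a target formation: $e(\bar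 Hy)=0$, $\{\mathbb{G},y\}$ is infinitesimally rigid, and so is every $\{\mathbb{G},x\}$ with the same edge lengths. Let $T$ be the edge set of a spanning subgraph $\tilde{\mathbb{G}}$ for which $\{\tilde{\mathbb{G}},y\}$ is minimally infinitesimally rigid. Call an open set $\mathcal{A}\subset\mathbb{R}^{2n}$ containing $y$ an ambient space if it is invariant under translations and rotations of the plane, $\{\tilde{\mathbb{G}},x\}$ is minimally infinitesimally rigid for all $x\in\mathcal{A}$, and any two points $x,x'\in\mathcal{A}$ with $\tilde Pe(\bar Hx)=\tilde Pe(\bar Hx')$ differ by a translation and a rotation. On $\tilde Pe(\bar H\mathcal{A})$ let $\psi$ be the function with $\widehat Pe(\bar Hx)=\psi(\tilde Pe(\bar Hx))$ for $x\in\mathcal{A}$, let $F=\partial\psi/\partial\epsilon$, and let $g$ be defined by $$g(\epsilon,\mu)=-2\tilde R\tilde R'\epsilon-2\tilde R\tilde R'F'(\epsilon)\psi(\epsilon)+2\tilde RS'\mu,$$ with $\tilde R,S$ evaluated at $\bar Hx$ for any $x\in\mathcal{A}$ with $\tilde Pe(\bar Hx)=\epsilon$. The error system is $\dot\epsilon=g(\epsilon,\mu)$.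 Theorem. Ambient spaces exist. Let $\mathcal{A}$ be any ambient space. On some open neighbourhood $\mathcal{M}_1$ of $0\in\mathbb{R}^m$ there is a smooth function $\mu\mapsto\epsilon_\mu\in\tilde Pe(\bar H\mathcal{A})$ with $\epsilon_0=0$ and $g(\epsilon_\mu,\mu)=0$ for all $\mu\in\mathcal{M}_1$. For any such function let $\mathfrak{e}_\mu=\tilde P'\epsilon_\mu+\widehat P'\psi(\epsilon_\mu)$ be the equilibrium output of the error system. Then for every sufficiently small open neighbourhood $\mathcal{M}\subset\mathcal{M}_1$ of $0$ and every $\mu\in\mathcal{M}$ there are $\delta,c,r>0$ such that for every $x(0)\in\mathcal{A}$ with $\|e(\bar Hx(0))-\mathfrak{e}_\mu\|<\delta$: 1. the trajectory $x(t)$ of the overall system starting at $x(0)$ exists for all $t\ge 0$ and lies in $\mathcal{A}$; 2. the error converges exponentially fast to $\mathfrak{e}_\mu$: $\|e(\bar Hx(t))-\mathfrak{e}_\mu\|\le c\,e^{-rt}$ for all $t\ge 0$. -/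

import Mathlib

open scoped Matrix Kronecker ContDiff Topology

noncomputable section

namespace Formation

/-- A multi-point `x = (x_1, …, x_n)` in the plane: `x (i, c)` is the `c`-th coordinate of `x_i`.
The sup norm that Lean puts on such function spaces is equivalent to the Euclidean one, and it is
only used below where the choice of the norm is irrelevant; the lengths `‖z_k‖²` are written out
as sums of squares. -/
abbrev MultiPoint (n : ℕ) := Fin n × Fin 2 → ℝ

/-- A simple graph with vertices labelled by `Fin n` and edges labelled by `Fin m`, together with
an orientation of every edge: no loops and no two labels for the same (unordered) edge. -/
structure OrientedGraph (n m : ℕ) where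
  head : Fin m → Fin n
  tail : Fin m → Fin n
  head_ne_tail : ∀ k, head k ≠ tail k
  edge_injective : Function.Injective fun k => s(head k, tail k)

variable {n m : ℕ}

namespace OrientedGraph

variable (G : OrientedGraph n m)

/-- The transpose of the incidence matrix: `1` at the head and `-1` at the tail of each edge. -/
def H : Matrix (Fin m) (Fin n) ℝ :=
  Matrix.of fun k i => if i = G.head k then 1 else if i = G.tail k then -1 else 0

/-- `H̄ = H ⊗ I`, with `I` the `2 × 2` identity. -/
def Hbar : Matrix (Fin m × Fin 2) (Fin n × Fin 2) ℝ :=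
  G.H ⊗ₖ (1 : Matrix (Fin 2) (Fin 2) ℝ)

/-- `J̄`: the negative entries of `-H̄` are replaced by zeros. -/
def Jbar : Matrix (Fin m × Fin 2) (Fin n × Fin 2) ℝ :=
  Matrix.of fun a b => max (-(G.Hbar a b)) 0

/-- The relative positions `z = H̄ x`; `z (k, ·)` is `x_i - x_j`, with `i` the head and `j` the
tail of edge `k`. -/
def z (x : MultiPoint n) : Fin m × Fin 2 → ℝ := G.Hbar *ᵥ x

end OrientedGraph

/-- `D(z) = diagonal {z_1, …, z_m}`, a `2m × m` matrix with blocks `z_k`. -/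
def D (z : Fin m × Fin 2 → ℝ) : Matrix (Fin m × Fin 2) (Fin m) ℝ :=
  Matrix.of fun a l => if a.1 = l then z a else 0

/-- The error `e(z)`, with components `e_k(z) = ‖z_k‖² - d_k²`. -/
def err (d : Fin m → ℝ) (z : Fin m × Fin 2 → ℝ) : Fin m → ℝ :=
  fun k => (∑ c, z (k, c) ^ 2) - d k ^ 2

/-- The matrix `P̃` that selects the entries with labels in `T`. -/
def Ptilde (T : Finset (Fin m)) : Matrix {k // k ∈ T} (Fin m) ℝ :=
  Matrix.of fun a k => if (a : Fin m) = k then 1 else 0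

/-- The matrix `P̂` that selects the entries with labels outside `T`. -/
def Phat (T : Finset (Fin m)) : Matrix {k // k ∉ T} (Fin m) ℝ :=
  Matrix.of fun a k => if (a : Fin m) = k then 1 else 0

/-- `x'` lies in the orbit of `x` under the group generated by the translations and the
rotations of the plane. -/
def SameOrbit (x x' : MultiPoint n) : Prop :=
  ∃ A ∈ Matrix.specialOrthogonalGroup (Fin 2) ℝ, ∃ v : Fin 2 → ℝ,
    ∀ i, (fun c => x' (i, c)) = A *ᵥ (fun c => x (i, c)) + v

namespace OrientedGraph

variable (G : OrientedGraph n m)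

/-- `R(z) = D(z)' H̄`; at `z = H̄ x` it is the rigidity matrix of the framework, that is, half the
Jacobian matrix of the edge function `x ↦ (‖z_k‖²)_k`. -/
def R (z : Fin m × Fin 2 → ℝ) : Matrix (Fin m) (Fin n × Fin 2) ℝ := (D z)ᵀ * G.Hbar

/-- `S(z) = D(z)' J̄`. -/
def S (z : Fin m × Fin 2 → ℝ) : Matrix (Fin m) (Fin n × Fin 2) ℝ := (D z)ᵀ * G.Jbar

/-- `R̃(z) = P̃ R(z)`; at `z = H̄ x` it is the rigidity matrix of the framework whose graph is the
spanning subgraph with edge set `T`. -/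
def Rtilde (T : Finset (Fin m)) (z : Fin m × Fin 2 → ℝ) :
    Matrix {k // k ∈ T} (Fin n × Fin 2) ℝ :=
  Ptilde T * G.R z

/-- The framework at `x` whose graph is the spanning subgraph with edge set `T` is infinitesimally
rigid. -/
def InfRigid (T : Finset (Fin m)) (x : MultiPoint n) : Prop :=
  (G.Rtilde T (G.z x)).rank = 2 * n - 3

/-- Minimal infinitesimal rigidity: infinitesimally rigid, and no longer so after the removal of
any edge. -/
def MinInfRigid (T : Finset (Fin m)) (x : MultiPoint n) : Prop :=
  G.InfRigid T x ∧ ∀ k ∈ T, ¬ G.InfRigid (T.erase k) x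

/-- Two frameworks on `G` are equivalent if they have the same edge lengths. -/
def Equivalent (x y : MultiPoint n) : Prop :=
  ∀ k, ∑ c, G.z x (k, c) ^ 2 = ∑ c, G.z y (k, c) ^ 2

/-- `(G, y)` is a target formation for the target distances `d`: the distances are positive and
realized by `y`, the formation at `y` is infinitesimally rigid, and so is every formation that is
equivalent to it. -/
structure IsTarget (d : Fin m → ℝ) (y : MultiPoint n) : Prop where
  dist_pos : ∀ k, 0 < d k
  realizes : ∀ k, ∑ c, G.z y (k, c) ^ 2 = d k ^ 2
  rigid : G.InfRigid Finset.univ y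
  rigid_of_equivalent : ∀ x, G.Equivalent x y → G.InfRigid Finset.univ x

/-- The right-hand side `-R'(z) e(z) + S'(z) μ`, `z = H̄ x`, of the overall system. -/
def overallField (d : Fin m → ℝ) (μ : Fin m → ℝ) (x : MultiPoint n) : MultiPoint n :=
  -((G.R (G.z x))ᵀ *ᵥ err d (G.z x)) + (G.S (G.z x))ᵀ *ᵥ μ

/-- `x` is a trajectory of the overall system on `[0, ∞)` that starts at `x₀`. -/
def IsTrajectory (d : Fin m → ℝ) (μ : Fin m → ℝ) (x₀ : MultiPoint n) (x : ℝ → MultiPoint n) :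
    Prop :=
  x 0 = x₀ ∧
    ∀ t, 0 ≤ t → HasDerivWithinAt x (G.overallField d μ (x t)) (Set.Ici 0) t

/-- The reduced error `x ↦ P̃ e(H̄ x)`. -/
def reducedErr (d : Fin m → ℝ) (T : Finset (Fin m)) (x : MultiPoint n) : {k // k ∈ T} → ℝ :=
  Ptilde T *ᵥ err d (G.z x)

/-- `A` is an ambient space for the target formation at `y` and the reduced graph with edge set
`T`: an open set around `y`, invariant under translations and rotations, on which the reduced
formation is minimally infinitesimally rigid, and on which the reduced error determines the
formation up to translation and rotation. (So each inner product `(x_i - x_j)'(x_k - x_l)` is on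
`A` a function of the reduced error; by rigidity this function is smooth.) -/
structure IsAmbientSpace (d : Fin m → ℝ) (T : Finset (Fin m)) (y : MultiPoint n)
    (A : Set (MultiPoint n)) : Prop where
  isOpen : IsOpen A
  target_mem : y ∈ A
  invariant : ∀ x ∈ A, ∀ x', SameOrbit x x' → x' ∈ A
  rigid : ∀ x ∈ A, G.MinInfRigid T x
  orbit_eq : ∀ x ∈ A, ∀ x' ∈ A, G.reducedErr d T x = G.reducedErr d T x' → SameOrbit x x'

/-- A point `x ∈ A` with `P̃ e(H̄ x) = ε`, for `ε ∈ P̃ e(H̄ A)`. On an ambient space it is unique up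
to translation and rotation, and what is formed from it below does not depend on the choice. -/
def rep (d : Fin m → ℝ) (T : Finset (Fin m)) (A : Set (MultiPoint n)) (ε : {k // k ∈ T} → ℝ) :
    MultiPoint n :=
  Function.invFunOn (G.reducedErr d T) A ε

/-- The function `ψ` on `P̃ e(H̄ A)` with `P̂ e(H̄ x) = ψ (P̃ e(H̄ x))` for `x ∈ A`. -/
def psi (d : Fin m → ℝ) (T : Finset (Fin m)) (A : Set (MultiPoint n)) (ε : {k // k ∈ T} → ℝ) :
    {k // k ∉ T} → ℝ :=
  Phat T *ᵥ err d (G.z (G.rep d T A ε))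

/-- The Jacobian matrix `F` of `ψ`. -/
def F (d : Fin m → ℝ) (T : Finset (Fin m)) (A : Set (MultiPoint n)) (ε : {k // k ∈ T} → ℝ) :
    Matrix {k // k ∉ T} {k // k ∈ T} ℝ :=
  LinearMap.toMatrix' (fderiv ℝ (G.psi d T A) ε : ({k // k ∈ T} → ℝ) →ₗ[ℝ] ({k // k ∉ T} → ℝ))

/-- The right-hand side `g(ε, μ) = -2 R̃R̃'ε - 2 R̃R̃'F'(ε)ψ(ε) + 2 R̃S'μ` of the error system, for
`ε ∈ P̃ e(H̄ A)`, where `R̃` and `S` are taken at any `x ∈ A` with `P̃ e(H̄ x) = ε`. -/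
def g (d : Fin m → ℝ) (T : Finset (Fin m)) (A : Set (MultiPoint n)) (ε : {k // k ∈ T} → ℝ)
    (μ : Fin m → ℝ) : {k // k ∈ T} → ℝ :=
  let Rt := G.Rtilde T (G.z (G.rep d T A ε))
  let S := G.S (G.z (G.rep d T A ε))
  (-2 : ℝ) • ((Rt * Rtᵀ) *ᵥ ε) - (2 : ℝ) • ((Rt * Rtᵀ * (G.F d T A ε)ᵀ) *ᵥ G.psi d T A ε)
    + (2 : ℝ) • ((Rt * Sᵀ) *ᵥ μ)

/-- `μ ↦ ε_μ` is the smooth branch, on the open neighbourhood `M` of `0`, of equilibrium states of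
the error systems `ε' = g(ε, μ)` that passes through `ε_0 = 0`. -/
structure IsEquilibriumBranch (d : Fin m → ℝ) (T : Finset (Fin m)) (A : Set (MultiPoint n))
    (M : Set (Fin m → ℝ)) (ε : (Fin m → ℝ) → {k // k ∈ T} → ℝ) : Prop where
  isOpen : IsOpen M
  zero_mem : 0 ∈ M
  smooth : ContDiffOn ℝ ∞ ε M
  map_zero : ε 0 = 0
  mem : ∀ μ ∈ M, ε μ ∈ G.reducedErr d T '' A
  equilibrium : ∀ μ ∈ M, G.g d T A (ε μ) μ = 0

/-- The output `P̃'ε + P̂'ψ(ε)` of the error system in state `ε`; at `ε = ε_μ` it is the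
equilibrium output `𝔢_μ`. -/
def output (d : Fin m → ℝ) (T : Finset (Fin m)) (A : Set (MultiPoint n))
    (ε : {k // k ∈ T} → ℝ) : Fin m → ℝ :=
  (Ptilde T)ᵀ *ᵥ ε + (Phat T)ᵀ *ᵥ G.psi d T A ε

end OrientedGraph

end Formation

end

/-! Interactions depend on `x` only modulo rigid motions of the plane, so the dynamics is studied
through the reduced error `ε = P̃e`. Minimal rigidity makes `R̃R̃'` invertible, so the derivative
`2R̃` of `ε` is onto and has smooth local sections. On an ambient space the full error is therefore
a smooth function of `ε`, the output, with Jacobian `Λ = P̃' + P̂'F`. The chain rule gives `R = ΛR̃`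
(`IsAmbientSpace.R_eq`), hence `R'e = R̃'(ε + F'ψ)`, and `ε` obeys the error system
(`IsAmbientSpace.g_reducedErr`).

Since `e` vanishes at the target, the linearization of `g` in `ε` at `(0, 0)` is `-2 R̃R̃' Λ'Λ`,
where both `R̃R̃'` and `Λ'Λ` are positive definite. It is invertible, so the implicit function
theorem yields `ε_μ`; and `V(w) = |Λw|²` is a strict Lyapunov function. Strict differentiability of
`g` lets the same `V` serve for `ε - ε_μ`, uniformly in small `μ`
(`IsAmbientSpace.exists_lyapunov_decrease`), whence exponential decay.

A bound on `V` does not bound `x`, as orbits are unbounded. Two facts lead back to `x`. A trajectory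
whose reduced error stays in the image of `A` cannot leave `A`, because `A` is relatively closed
over that image (`IsAmbientSpace.mem_of_mem_closure`). And a bounded error bounds `z`, on which
alone the field depends, so there the field agrees with a bounded Lipschitz one, whose solutions are
global (`exists_truncatedField`).

Ambient spaces come from a slice: once a vertex and the direction of an edge are fixed, the reduced
error is injective near `y`, since the three-dimensional kernel of `R̃` consists of infinitesimal
rigid motions (`exists_isAmbientSpace`). -/

noncomputable section

namespace Formation

open Set Filter

/-! ### Local sections, quadratic forms and differential equations on the half-line -/

section Analysis

variable {E F : Type*} [NormedAddCommGroup E] [NormedSpace ℝ E] [NormedAddCommGroup F]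
  [NormedSpace ℝ F]

/-- An analytic map whose derivative at `a` has a right inverse has an analytic local section
through `a`. -/
theorem exists_contDiffAt_section [CompleteSpace F] {f : E → F} {f' : E →L[ℝ] F} {a : E}
    (hf : ContDiffAt ℝ ω f a) (hf' : HasFDerivAt f f' a) (r : F →L[ℝ] E)
    (hr : ∀ w, f' (r w) = w) :
    ∃ σ : F → E, ContDiffAt ℝ ω σ (f a) ∧ σ (f a) = a ∧ ∀ᶠ w in 𝓝 (f a), f (σ w) = w := by
  have h0 : a + r 0 = a := by simp
  -- Restricted to the affine space `a + range r`, the map has derivative `f' ∘ r = id`, so the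
  -- inverse function theorem applies.
  have hφ : ContDiffAt ℝ ω (fun w => a + r w) 0 := by fun_prop
  have hk : ContDiffAt ℝ ω (fun w => f (a + r w)) 0 :=
    ContDiffAt.comp (0 : F) (by rwa [h0]) hφ
  have hk' : HasFDerivAt (fun w => f (a + r w))
      ((ContinuousLinearEquiv.refl ℝ F : F ≃L[ℝ] F) : F →L[ℝ] F) 0 := by
    have h1 : HasFDerivAt (fun w => a + r w) r 0 := r.hasFDerivAt.const_add a
    have h2 : HasFDerivAt f f' (a + r 0) := by rwa [h0]
    have h3 : ((ContinuousLinearEquiv.refl ℝ F : F ≃L[ℝ] F) : F →L[ℝ] F) = f'.comp r := by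
      ext w
      simp [hr]
    rw [h3]
    exact h2.comp (0 : F) h1
  have hω : (ω : WithTop ℕ∞) ≠ 0 := by simp
  have hk0 : f (a + r 0) = f a := by rw [h0]
  refine ⟨fun w => a + r (hk.localInverse hk' hω w), ?_, ?_, ?_⟩
  · have := hk.to_localInverse hk' hω
    simp only [hk0] at this
    fun_prop
  · have := hk.localInverse_apply_image hk' hω
    simp only [hk0] at this
    simp [this]
  · have := (hk.hasStrictFDerivAt' hk' hω).eventually_right_inverse
    simp only [hk0] at this
    exact this

/-- A map with injective strict derivative on a finite-dimensional space is locally injective. -/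
theorem exists_ball_injOn [FiniteDimensional ℝ E] {f : E → F} {f' : E →L[ℝ] F}
    {a : E} (hf : HasStrictFDerivAt f f' a) (hinj : ∀ v, f' v = 0 → v = 0) :
    ∃ ρ > 0, InjOn f (Metric.ball a ρ) := by
  have hker : LinearMap.ker (f' : E →ₗ[ℝ] F) = ⊥ := by
    rw [LinearMap.ker_eq_bot']
    exact hinj
  obtain ⟨K, hK, hanti⟩ := (f' : E →ₗ[ℝ] F).exists_antilipschitzWith hker
  have hbound : ∀ v, ‖v‖ ≤ K * ‖f' v‖ := fun v => by
    simpa using hanti.le_mul_dist v 0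
  -- With half the antilipschitz rate of `f'` as error, `f p = f q` forces `‖p - q‖ ≤ ‖p - q‖ / 2`.
  have hlo := hf.isLittleO.def (show (0 : ℝ) < (K : ℝ)⁻¹ / 2 by positivity)
  obtain ⟨ρ, hρ, hball⟩ := Metric.eventually_nhds_iff_ball.1 hlo
  refine ⟨ρ, hρ, fun p hp q hq hpq => ?_⟩
  have h1 := hball (p, q) (by
    rw [← ball_prod_same]
    exact ⟨hp, hq⟩)
  simp only [hpq, sub_self, zero_sub, norm_neg] at h1
  have h2 := hbound (p - q)
  have hK' : (0 : ℝ) < K := by exact_mod_cast hK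
  have h3 : (K : ℝ) * ‖f' (p - q)‖ ≤ K * ((K : ℝ)⁻¹ / 2 * ‖p - q‖) := by gcongr
  have h4 : (K : ℝ) * ((K : ℝ)⁻¹ / 2 * ‖p - q‖) = ‖p - q‖ / 2 := by field_simp
  have h5 : ‖p - q‖ ≤ 0 := by linarith
  exact sub_eq_zero.1 (norm_le_zero_iff.1 h5)

/-- A positive definite quadratic function on a finite-dimensional space is comparable to the
square of the norm. -/
theorem exists_sq_norm_bounds [FiniteDimensional ℝ E] {q : E → ℝ} (hq : Continuous q)
    (hsmul : ∀ (t : ℝ) w, q (t • w) = t ^ 2 * q w) (hpos : ∀ w, w ≠ 0 → 0 < q w) :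
    ∃ a > 0, ∃ b > 0, ∀ w, a * ‖w‖ ^ 2 ≤ q w ∧ q w ≤ b * ‖w‖ ^ 2 := by
  have hq0 : q 0 = 0 := by simpa using hsmul 0 0
  rcases (Metric.sphere (0 : E) 1).eq_empty_or_nonempty with hS | hS
  · refine ⟨1, one_pos, 1, one_pos, fun w => ?_⟩
    have : w = 0 := by
      by_contra hw
      have : (‖w‖⁻¹ • w) ∈ Metric.sphere (0 : E) 1 := by
        simp [norm_smul, hw]
      simp [hS] at this
    simp [this, hq0]
  · have hc : IsCompact (Metric.sphere (0 : E) 1) := isCompact_sphere 0 1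
    obtain ⟨u, hu, humin⟩ := hc.exists_isMinOn hS hq.continuousOn
    obtain ⟨v, hv, hvmax⟩ := hc.exists_isMaxOn hS hq.continuousOn
    have hne : ∀ u ∈ Metric.sphere (0 : E) 1, u ≠ 0 := by
      rintro u hu rfl
      simp at hu
    refine ⟨q u, hpos u (hne u hu), q v, hpos v (hne v hv), fun w => ?_⟩
    rcases eq_or_ne w 0 with rfl | hw
    · simp [hq0]
    · have hmem : (‖w‖⁻¹ • w) ∈ Metric.sphere (0 : E) 1 := by
        simp [norm_smul, hw]
      have hn : 0 < ‖w‖ := norm_pos_iff.2 hw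
      have h1 : q u ≤ q (‖w‖⁻¹ • w) := humin hmem
      have h2 : q (‖w‖⁻¹ • w) ≤ q v := hvmax hmem
      have h3 : q w = q (‖w‖⁻¹ • w) * ‖w‖ ^ 2 := by
        rw [hsmul]
        field_simp
      rw [h3]
      constructor <;> gcongr

/-- A bounded Lipschitz vector field has integral curves on `[0, ∞)`. -/
theorem exists_forward_solution [CompleteSpace E] {f : E → E} {K L : NNReal}
    (hf : LipschitzWith K f) (hL : ∀ x, ‖f x‖ ≤ L) (x₀ : E) :
    ∃ x : ℝ → E, x 0 = x₀ ∧ ∀ t, 0 ≤ t → HasDerivWithinAt x (f (x t)) (Ici 0) t := by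
  have hex : ∀ N : ℕ, ∃ α : ℝ → E, α 0 = x₀ ∧
      ∀ t ∈ Icc (0 : ℝ) N, HasDerivWithinAt α (f (α t)) (Icc (0 : ℝ) N) t := by
    intro N
    -- At speed at most `L` a solution moves no further than `L * N` in time `N`, and the Lipschitz
    -- bound is global, so this radius is admissible for every `N`.
    have hpl : IsPicardLindelof (fun _ => f) (⟨0, by simp⟩ : Icc (0 : ℝ) N) x₀
        (L * N) 0 L K :=
      { lipschitzOnWith := fun t _ => hf.lipschitzOnWith
        continuousOn := fun x _ => continuousOn_const
        norm_le := fun t _ x _ => hL x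
        mul_max_le := by simp }
    exact hpl.exists_eq_forall_mem_Icc_hasDerivWithinAt₀
  choose α hα0 hα using hex
  have hagree : ∀ M N : ℕ, M ≤ N → EqOn (α M) (α N) (Icc (0 : ℝ) M) := by
    intro M N hMN
    have hMN' : (M : ℝ) ≤ N := by exact_mod_cast hMN
    have key : ∀ J : ℕ, M ≤ J → ContinuousOn (α J) (Icc (0 : ℝ) M) ∧
        ∀ t ∈ Ico (0 : ℝ) M, HasDerivWithinAt (α J) (f (α J t)) (Ici t) t := by
      intro J hJ
      have hJ' : (M : ℝ) ≤ J := by exact_mod_cast hJ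
      refine ⟨fun t ht => ?_, fun t ht => ?_⟩
      · exact ((hα J t ⟨ht.1, ht.2.trans hJ'⟩).continuousWithinAt).mono
          (Icc_subset_Icc_right hJ')
      · have h1 := hα J t ⟨ht.1, ht.2.le.trans hJ'⟩
        refine h1.mono_of_mem_nhdsWithin ?_
        refine mem_of_superset (Icc_mem_nhdsGE (ht.2.trans_le hJ')) ?_
        exact Icc_subset_Icc_left ht.1
    exact ODE_solution_unique_of_mem_Icc_right (v := fun _ => f) (s := fun _ => univ) (K := K)
      (fun t _ => hf.lipschitzOnWith) (key M le_rfl).1 (key M le_rfl).2 (fun _ _ => mem_univ _)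
      (key N hMN).1 (key N hMN).2 (fun _ _ => mem_univ _) (by rw [hα0, hα0])
  -- The `+ 1` puts `t` strictly before the right end of its interval, so that interval is a
  -- neighbourhood of `t` in `[0, ∞)`.
  refine ⟨fun t => α (⌊t⌋₊ + 1) t, hα0 _, fun t ht => ?_⟩
  have hlt : t < (⌊t⌋₊ + 1 : ℕ) := by
    push_cast
    exact Nat.lt_floor_add_one t
  have heq : ∀ s ∈ Icc (0 : ℝ) (⌊t⌋₊ + 1 : ℕ), α (⌊s⌋₊ + 1) s = α (⌊t⌋₊ + 1) s := by
    intro s hs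
    rcases le_total (⌊s⌋₊ + 1) (⌊t⌋₊ + 1) with h | h
    · refine hagree _ _ h ⟨hs.1, ?_⟩
      push_cast
      exact (Nat.lt_floor_add_one s).le
    · exact (hagree _ _ h hs).symm
  have h1 := hα (⌊t⌋₊ + 1) t ⟨ht, hlt.le⟩
  have hnhds : Icc (0 : ℝ) (⌊t⌋₊ + 1 : ℕ) ∈ 𝓝[Ici 0] t := by
    have : Iic ((⌊t⌋₊ + 1 : ℕ) : ℝ) ∈ 𝓝 t := Iic_mem_nhds hlt
    have := inter_mem_nhdsWithin (Ici (0 : ℝ)) this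
    rwa [Ici_inter_Iic] at this
  exact (h1.congr heq (heq t ⟨ht, hlt.le⟩)).mono_of_mem_nhdsWithin hnhds

/-- Gronwall's inequality in the form of exponential decay. -/
theorem le_mul_exp_of_deriv_le {V V' : ℝ → ℝ} {ρ b : ℝ} (hc : ContinuousOn V (Icc 0 b))
    (hd : ∀ t ∈ Ico 0 b, HasDerivWithinAt V (V' t) (Ici t) t)
    (hV : ∀ t ∈ Ico 0 b, V' t ≤ -ρ * V t) :
    ∀ t ∈ Icc 0 b, V t ≤ V 0 * Real.exp (-ρ * t) := by
  intro t ht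
  have := le_gronwallBound_of_liminf_deriv_right_le (f := V) (f' := V') (δ := V 0) (K := -ρ)
    (ε := 0) hc (fun s hs r hr => (hd s hs).liminf_right_slope_le hr) le_rfl
    (by simpa using hV) t ht
  simpa [gronwallBound_ε0] using this

/-- A curve that starts in an open set `U` stays there if it can only leave it at a time `b`
at which, as long as it was in `U` before, it is in `U`. -/
theorem forall_mem_of_forall_lt {X : Type*} [TopologicalSpace X] {U : Set X} (hU : IsOpen U)
    {x : ℝ → X} (hx : ContinuousOn x (Ici 0))
    (hstep : ∀ b, 0 ≤ b → (∀ t, 0 ≤ t → t < b → x t ∈ U) → x b ∈ U) :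
    ∀ t, 0 ≤ t → x t ∈ U := by
  by_contra! hcon
  obtain ⟨t₁, ht₁, hbad⟩ := hcon
  set B : Set ℝ := {t | 0 ≤ t ∧ x t ∉ U} with hB
  have hBne : B.Nonempty := ⟨t₁, ht₁, hbad⟩
  have hBbdd : BddBelow B := ⟨0, fun t ht => ht.1⟩
  have hBcl : IsClosed B := by
    have : B = Ici 0 ∩ x ⁻¹' Uᶜ := by
      ext t
      simp [hB]
    rw [this]
    exact hx.preimage_isClosed_of_isClosed isClosed_Ici hU.isClosed_compl
  have hmem := hBcl.csInf_mem hBne hBbdd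
  refine hmem.2 (hstep _ hmem.1 fun t ht hlt => ?_)
  by_contra h
  exact absurd (csInf_le hBbdd (show t ∈ B from ⟨ht, h⟩)) (not_le.2 hlt)

end Analysis

variable {n m : ℕ}

/-! ### Orbits under translations and rotations -/

section Orbit

theorem mem_specialOrthogonalGroup_two {A : Matrix (Fin 2) (Fin 2) ℝ}
    (hA : A ∈ Matrix.specialOrthogonalGroup (Fin 2) ℝ) :
    A 1 1 = A 0 0 ∧ A 0 1 = -A 1 0 ∧ A 0 0 ^ 2 + A 1 0 ^ 2 = 1 := by
  rw [Matrix.mem_specialOrthogonalGroup_iff] at hA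
  obtain ⟨h1, h2⟩ := hA
  rw [Matrix.mem_orthogonalGroup_iff'] at h1
  rw [Matrix.det_fin_two] at h2
  have h00 := congrFun (congrFun h1 0) 0
  have h01 := congrFun (congrFun h1 0) 1
  have h11 := congrFun (congrFun h1 1) 1
  simp [Matrix.mul_apply, Fin.sum_univ_two] at h00 h01 h11
  have e1 : A 1 1 = A 0 0 := by
    linear_combination A 0 0 * h2 + A 1 0 * h01 - A 1 1 * h00
  have e2 : A 0 1 = -A 1 0 := by
    linear_combination -A 1 0 * h2 + A 0 0 * h01 - A 0 1 * h00
  exact ⟨e1, e2, by linear_combination h00⟩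

theorem rotation_mem {p q : ℝ} (h : p ^ 2 + q ^ 2 = 1) :
    !![p, -q; q, p] ∈ Matrix.specialOrthogonalGroup (Fin 2) ℝ := by
  rw [Matrix.mem_specialOrthogonalGroup_iff, Matrix.mem_orthogonalGroup_iff']
  constructor
  · ext i j
    fin_cases i <;> fin_cases j <;>
      simp [Matrix.mul_apply, Fin.sum_univ_two] <;> linarith
  · rw [Matrix.det_fin_two]
    simp
    linarith

theorem sameOrbit_iff {x x' : MultiPoint n} :
    SameOrbit x x' ↔ ∃ p q a b : ℝ, p ^ 2 + q ^ 2 = 1 ∧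
      ∀ i, x' (i, 0) = p * x (i, 0) - q * x (i, 1) + a ∧
        x' (i, 1) = q * x (i, 0) + p * x (i, 1) + b := by
  constructor
  · rintro ⟨A, hA, v, h⟩
    obtain ⟨h1, h2, h3⟩ := mem_specialOrthogonalGroup_two hA
    refine ⟨A 0 0, A 1 0, v 0, v 1, h3, fun i => ⟨?_, ?_⟩⟩
    · have := congrFun (h i) 0
      simp [h2] at this
      linarith
    · have := congrFun (h i) 1
      simp [h1] at this
      linarith
  · rintro ⟨p, q, a, b, h, hx⟩
    refine ⟨_, rotation_mem h, ![a, b], fun i => ?_⟩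
    ext c
    fin_cases c
    · simp [(hx i).1, Matrix.vecHead, Matrix.vecTail]
      ring
    · simp [(hx i).2, Matrix.vecHead, Matrix.vecTail]

theorem SameOrbit.refl (x : MultiPoint n) : SameOrbit x x :=
  sameOrbit_iff.2 ⟨1, 0, 0, 0, by norm_num, fun i => by simp⟩

theorem SameOrbit.symm {x x' : MultiPoint n} (h : SameOrbit x x') : SameOrbit x' x := by
  obtain ⟨p, q, a, b, h1, h2⟩ := sameOrbit_iff.1 h
  refine sameOrbit_iff.2 ⟨p, -q, -(p * a + q * b), -(p * b - q * a), by linarith, fun i => ?_⟩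
  obtain ⟨h3, h4⟩ := h2 i
  rw [h3, h4]
  constructor
  · linear_combination -x (i, 0) * h1
  · linear_combination -x (i, 1) * h1

theorem SameOrbit.trans {x x' x'' : MultiPoint n} (h : SameOrbit x x') (h' : SameOrbit x' x'') :
    SameOrbit x x'' := by
  obtain ⟨p, q, a, b, h1, h2⟩ := sameOrbit_iff.1 h
  obtain ⟨p', q', a', b', h1', h2'⟩ := sameOrbit_iff.1 h'
  refine sameOrbit_iff.2 ⟨p' * p - q' * q, q' * p + p' * q, p' * a - q' * b + a',
    q' * a + p' * b + b', ?_, fun i => ?_⟩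
  · linear_combination (p' ^ 2 + q' ^ 2) * h1 + h1'
  · obtain ⟨h3, h4⟩ := h2 i
    obtain ⟨h5, h6⟩ := h2' i
    rw [h5, h6, h3, h4]
    constructor <;> ring

/-- A rotation followed by a translation, acting on multi-points. -/
def move (p q a b : ℝ) (x : MultiPoint n) : MultiPoint n := fun ic =>
  if ic.2 = 0 then p * x (ic.1, 0) - q * x (ic.1, 1) + a
  else q * x (ic.1, 0) + p * x (ic.1, 1) + b

theorem continuous_move (p q a b : ℝ) : Continuous (move p q a b : MultiPoint n → _) := by
  refine continuous_pi fun ic => ?_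
  unfold move
  split_ifs <;> fun_prop

theorem sameOrbit_iff_move {x x' : MultiPoint n} :
    SameOrbit x x' ↔ ∃ p q a b : ℝ, p ^ 2 + q ^ 2 = 1 ∧ x' = move p q a b x := by
  rw [sameOrbit_iff]
  constructor
  · rintro ⟨p, q, a, b, h, hx⟩
    refine ⟨p, q, a, b, h, ?_⟩
    ext ⟨i, c⟩
    fin_cases c
    · simpa [move] using (hx i).1
    · simpa [move] using (hx i).2
  · rintro ⟨p, q, a, b, h, rfl⟩
    exact ⟨p, q, a, b, h, fun i => by simp [move]⟩

/-- A rotation is not an isometry of the sup norm; the factor 2 is enough for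
`IsAmbientSpace.mem_of_mem_closure`. -/
theorem norm_move_sub_le {p q a b : ℝ} (h : p ^ 2 + q ^ 2 = 1) (x y : MultiPoint n) :
    ‖move p q a b x - move p q a b y‖ ≤ 2 * ‖x - y‖ := by
  have hp : |p| ≤ 1 := abs_le_one_iff_mul_self_le_one.2 (by nlinarith [sq_nonneg q])
  have hq : |q| ≤ 1 := abs_le_one_iff_mul_self_le_one.2 (by nlinarith [sq_nonneg p])
  have hxy : ∀ ic, |x ic - y ic| ≤ ‖x - y‖ := fun ic => by
    simpa using norm_le_pi_norm (x - y) ic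
  have key : ∀ r s : ℝ, |r| ≤ 1 → |s| ≤ 1 → ∀ i,
      |r * (x (i, 0) - y (i, 0)) + s * (x (i, 1) - y (i, 1))| ≤ 2 * ‖x - y‖ := by
    intro r s hr hs i
    refine (abs_add_le _ _).trans ?_
    rw [abs_mul, abs_mul]
    have h0 := mul_le_mul hr (hxy (i, 0)) (abs_nonneg _) zero_le_one
    have h1 := mul_le_mul hs (hxy (i, 1)) (abs_nonneg _) zero_le_one
    linarith
  refine (pi_norm_le_iff_of_nonneg (by positivity)).2 fun ⟨i, c⟩ => ?_
  rw [Real.norm_eq_abs]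
  fin_cases c
  · convert key p (-q) hp (by rwa [abs_neg]) i using 2
    simp [move]
    ring
  · convert key q p hq hp i using 2
    simp [move]
    ring

/-- The union of the orbits through an open set is open. -/
theorem isOpen_orbits {U : Set (MultiPoint n)} (hU : IsOpen U) :
    IsOpen {x : MultiPoint n | ∃ p ∈ U, SameOrbit x p} := by
  have : {x : MultiPoint n | ∃ p ∈ U, SameOrbit x p} =
      ⋃ (p : ℝ) (q : ℝ) (a : ℝ) (b : ℝ) (_ : p ^ 2 + q ^ 2 = 1), move p q a b ⁻¹' U := by
    ext x
    simp only [sameOrbit_iff_move, mem_ofPred_eq, mem_iUnion, mem_preimage, exists_prop]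
    constructor
    · rintro ⟨_, hp, p, q, a, b, h, rfl⟩
      exact ⟨p, q, a, b, h, hp⟩
    · rintro ⟨p, q, a, b, h, hp⟩
      exact ⟨_, hp, p, q, a, b, h, rfl⟩
  rw [this]
  exact isOpen_iUnion fun p => isOpen_iUnion fun q => isOpen_iUnion fun a => isOpen_iUnion fun b =>
    isOpen_iUnion fun _ => hU.preimage (continuous_move p q a b)

end Orbit

/-! ### The selection matrices -/

section Matrices

theorem Ptilde_mulVec (T : Finset (Fin m)) (v : Fin m → ℝ) (k : {k // k ∈ T}) :
    (Ptilde T *ᵥ v) k = v k := by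
  simp [Ptilde, Matrix.mulVec, dotProduct]

theorem Phat_mulVec (T : Finset (Fin m)) (v : Fin m → ℝ) (k : {k // k ∉ T}) :
    (Phat T *ᵥ v) k = v k := by
  simp [Phat, Matrix.mulVec, dotProduct]

theorem Ptilde_mul {ι : Type*} (T : Finset (Fin m)) (M : Matrix (Fin m) ι ℝ)
    (k : {k // k ∈ T}) (i : ι) : (Ptilde T * M) k i = M k i := by
  simp [Ptilde, Matrix.mul_apply]

theorem Ptilde_transpose_mulVec_add (T : Finset (Fin m)) (v : {k // k ∈ T} → ℝ)
    (w : {k // k ∉ T} → ℝ) (k : Fin m) :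
    ((Ptilde T)ᵀ *ᵥ v + (Phat T)ᵀ *ᵥ w) k =
      if h : k ∈ T then v ⟨k, h⟩ else w ⟨k, h⟩ := by
  have h1 : ((Ptilde T)ᵀ *ᵥ v) k = ∑ a : {k // k ∈ T}, if (a : Fin m) = k then v a else 0 := by
    simp [Ptilde, Matrix.mulVec, dotProduct]
  have h2 : ((Phat T)ᵀ *ᵥ w) k = ∑ a : {k // k ∉ T}, if (a : Fin m) = k then w a else 0 := by
    simp [Phat, Matrix.mulVec, dotProduct]
  rw [Pi.add_apply, h1, h2]
  split_ifs with h
  · rw [Finset.sum_eq_single_of_mem ⟨k, h⟩ (Finset.mem_univ _), Finset.sum_eq_zero]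
    · simp
    · rintro ⟨a, ha⟩ -
      rw [if_neg]
      rintro rfl
      exact ha h
    · rintro ⟨a, ha⟩ - hne
      rw [if_neg]
      rintro rfl
      exact hne rfl
  · rw [Finset.sum_eq_zero, Finset.sum_eq_single_of_mem ⟨k, h⟩ (Finset.mem_univ _)]
    · simp
    · rintro ⟨a, ha⟩ - hne
      rw [if_neg]
      rintro rfl
      exact hne rfl
    · rintro ⟨a, ha⟩ -
      rw [if_neg]
      rintro rfl
      exact h ha

theorem Ptilde_Phat_decomp (T : Finset (Fin m)) (v : Fin m → ℝ) :
    (Ptilde T)ᵀ *ᵥ (Ptilde T *ᵥ v) + (Phat T)ᵀ *ᵥ (Phat T *ᵥ v) = v := by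
  ext k
  rw [Ptilde_transpose_mulVec_add]
  split_ifs
  · rw [Ptilde_mulVec]
  · rw [Phat_mulVec]

end Matrices

/-! ### The rigidity matrix in coordinates, its invariance, and the derivative of the error -/

namespace OrientedGraph

variable (G : OrientedGraph n m)

theorem z_apply (x : MultiPoint n) (k : Fin m) (c : Fin 2) :
    G.z x (k, c) = x (G.head k, c) - x (G.tail k, c) := by
  have h : ∀ i, G.H k i = (if i = G.head k then 1 else 0) - (if i = G.tail k then 1 else 0) := by
    intro i
    have := G.head_ne_tail k
    simp only [H, Matrix.of_apply]
    split_ifs <;> simp_all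
  simp only [z, Hbar, Matrix.mulVec, dotProduct, Fintype.sum_prod_type,
    Matrix.kroneckerMap_apply, h, Matrix.one_apply]
  simp [sub_mul, Finset.sum_sub_distrib]

theorem z_move (p q a b : ℝ) (x : MultiPoint n) (k : Fin m) :
    G.z (move p q a b x) (k, 0) = p * G.z x (k, 0) - q * G.z x (k, 1) ∧
      G.z (move p q a b x) (k, 1) = q * G.z x (k, 0) + p * G.z x (k, 1) := by
  simp only [z_apply, move]
  constructor <;> simp <;> ring

/-- Rotations preserve inner products. The error, `R̃R̃'` and `R̃S'` depend on `x` only through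
these products, so `g` does not depend on the chosen representative. -/
theorem sum_z_mul_z_eq {x x' : MultiPoint n} (h : SameOrbit x x') (k l : Fin m) :
    ∑ c, G.z x' (k, c) * G.z x' (l, c) = ∑ c, G.z x (k, c) * G.z x (l, c) := by
  obtain ⟨p, q, a, b, h1, rfl⟩ := sameOrbit_iff_move.1 h
  simp only [Fin.sum_univ_two, (G.z_move p q a b x _).1, (G.z_move p q a b x _).2]
  linear_combination (G.z x (k, 0) * G.z x (l, 0) + G.z x (k, 1) * G.z x (l, 1)) * h1

theorem err_z_eq {x x' : MultiPoint n} (h : SameOrbit x x') (d : Fin m → ℝ) :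
    err d (G.z x') = err d (G.z x) := by
  ext k
  have := G.sum_z_mul_z_eq h k k
  simp only [err, sq, this]

theorem R_apply (z : Fin m × Fin 2 → ℝ) (k : Fin m) (i : Fin n) (c : Fin 2) :
    G.R z k (i, c) = G.H k i * z (k, c) := by
  simp only [R, Hbar, D, Matrix.mul_apply, Fintype.sum_prod_type, Matrix.transpose_apply,
    Matrix.of_apply, Matrix.kroneckerMap_apply, Matrix.one_apply]
  simp [mul_comm]

theorem S_apply (z : Fin m × Fin 2 → ℝ) (k : Fin m) (i : Fin n) (c : Fin 2) :
    G.S z k (i, c) = max (-G.H k i) 0 * z (k, c) := by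
  have h : ∀ c', G.Jbar (k, c') (i, c) = if c' = c then max (-G.H k i) 0 else 0 := by
    intro c'
    simp only [Jbar, Hbar, Matrix.of_apply, Matrix.kroneckerMap_apply, Matrix.one_apply]
    split_ifs <;> simp
  simp only [S, D, Matrix.mul_apply, Fintype.sum_prod_type, Matrix.transpose_apply,
    Matrix.of_apply]
  rw [Finset.sum_eq_single_of_mem k (Finset.mem_univ _)]
  · simp [h, mul_comm]
  · intro l _ hl
    simp [hl]

theorem R_mulVec (z : Fin m × Fin 2 → ℝ) (h : MultiPoint n) (k : Fin m) :
    (G.R z *ᵥ h) k = ∑ c, z (k, c) * G.z h (k, c) := by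
  have : G.R z *ᵥ h = (D z)ᵀ *ᵥ G.z h := by
    simp [R, OrientedGraph.z, Matrix.mulVec_mulVec]
  rw [this]
  simp only [D, Matrix.mulVec, dotProduct, Fintype.sum_prod_type, Matrix.transpose_apply,
    Matrix.of_apply]
  rw [Finset.sum_eq_single_of_mem k (Finset.mem_univ _)]
  · simp
  · intro l _ hl
    simp [hl]

theorem Rtilde_apply (T : Finset (Fin m)) (z : Fin m × Fin 2 → ℝ) (k : {k // k ∈ T})
    (j : Fin n × Fin 2) : G.Rtilde T z k j = G.R z k j :=
  Ptilde_mul T _ k j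

theorem Rtilde_mulVec (T : Finset (Fin m)) (z : Fin m × Fin 2 → ℝ) (h : MultiPoint n)
    (k : {k // k ∈ T}) : (G.Rtilde T z *ᵥ h) k = ∑ c, z (k, c) * G.z h (k, c) := by
  rw [Rtilde, ← Matrix.mulVec_mulVec, Ptilde_mulVec, R_mulVec]

theorem R_mul_R_transpose_eq {x x' : MultiPoint n} (h : SameOrbit x x') :
    G.R (G.z x') * (G.R (G.z x'))ᵀ = G.R (G.z x) * (G.R (G.z x))ᵀ := by
  ext k l
  have := G.sum_z_mul_z_eq h k l
  simp only [Matrix.mul_apply, Matrix.transpose_apply, Fintype.sum_prod_type, R_apply]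
  refine Finset.sum_congr rfl fun i _ => ?_
  calc _ = G.H k i * G.H l i * ∑ c, G.z x' (k, c) * G.z x' (l, c) := by
        rw [Finset.mul_sum]
        exact Finset.sum_congr rfl fun c _ => by ring
    _ = _ := by
        rw [this, Finset.mul_sum]
        exact Finset.sum_congr rfl fun c _ => by ring

theorem R_mul_S_transpose_eq {x x' : MultiPoint n} (h : SameOrbit x x') :
    G.R (G.z x') * (G.S (G.z x'))ᵀ = G.R (G.z x) * (G.S (G.z x))ᵀ := by
  ext k l
  have := G.sum_z_mul_z_eq h k l
  simp only [Matrix.mul_apply, Matrix.transpose_apply, Fintype.sum_prod_type, R_apply, S_apply]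
  refine Finset.sum_congr rfl fun i _ => ?_
  calc _ = G.H k i * max (-G.H l i) 0 * ∑ c, G.z x' (k, c) * G.z x' (l, c) := by
        rw [Finset.mul_sum]
        exact Finset.sum_congr rfl fun c _ => by ring
    _ = _ := by
        rw [this, Finset.mul_sum]
        exact Finset.sum_congr rfl fun c _ => by ring

theorem Rtilde_mul_Rtilde_transpose_eq (T : Finset (Fin m)) {x x' : MultiPoint n}
    (h : SameOrbit x x') :
    G.Rtilde T (G.z x') * (G.Rtilde T (G.z x'))ᵀ =
      G.Rtilde T (G.z x) * (G.Rtilde T (G.z x))ᵀ := by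
  have := G.R_mul_R_transpose_eq h
  simp only [Rtilde, Matrix.transpose_mul]
  rw [Matrix.mul_assoc, ← Matrix.mul_assoc (G.R _), this]
  simp only [Matrix.mul_assoc]

theorem Rtilde_mul_S_transpose_eq (T : Finset (Fin m)) {x x' : MultiPoint n}
    (h : SameOrbit x x') :
    G.Rtilde T (G.z x') * (G.S (G.z x'))ᵀ = G.Rtilde T (G.z x) * (G.S (G.z x))ᵀ := by
  have := G.R_mul_S_transpose_eq h
  simp only [Rtilde]
  rw [Matrix.mul_assoc, this, Matrix.mul_assoc]

theorem reducedErr_apply (d : Fin m → ℝ) (T : Finset (Fin m)) (x : MultiPoint n)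
    (k : {k // k ∈ T}) : G.reducedErr d T x k = err d (G.z x) k :=
  Ptilde_mulVec T _ k

theorem reducedErr_eq {x x' : MultiPoint n} (h : SameOrbit x x') (d : Fin m → ℝ)
    (T : Finset (Fin m)) : G.reducedErr d T x' = G.reducedErr d T x := by
  simp only [reducedErr, G.err_z_eq h]

theorem contDiff_z : ContDiff ℝ ω (G.z : MultiPoint n → _) := by
  refine contDiff_pi.2 fun kc => ?_
  have : (fun x => G.z x kc) = fun x : MultiPoint n =>
      x (G.head kc.1, kc.2) - x (G.tail kc.1, kc.2) := by
    ext x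
    exact G.z_apply x kc.1 kc.2
  rw [this]
  fun_prop

theorem continuous_Rtilde (T : Finset (Fin m)) :
    Continuous fun x : MultiPoint n => G.Rtilde T (G.z x) := by
  refine continuous_pi fun k => continuous_pi fun ⟨i, c⟩ => ?_
  simp only [Rtilde_apply, R_apply]
  have := G.contDiff_z.continuous
  fun_prop

theorem continuous_R : Continuous fun x : MultiPoint n => G.R (G.z x) := by
  refine continuous_pi fun k => continuous_pi fun ⟨i, c⟩ => ?_
  simp only [R_apply]
  have := G.contDiff_z.continuous
  fun_prop

theorem contDiff_err (d : Fin m → ℝ) : ContDiff ℝ ω (err d) := by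
  unfold err
  fun_prop

theorem contDiff_mulVec {ι κ : Type*} [Fintype κ] [Fintype ι] (A : Matrix ι κ ℝ) :
    ContDiff ℝ ω (fun v : κ → ℝ => A *ᵥ v) :=
  (LinearMap.toContinuousLinearMap A.mulVecLin).contDiff

theorem contDiff_reducedErr (d : Fin m → ℝ) (T : Finset (Fin m)) :
    ContDiff ℝ ω (G.reducedErr d T) :=
  (contDiff_mulVec _).comp ((contDiff_err d).comp G.contDiff_z)

/-- The derivative of the error is twice the rigidity matrix. -/
theorem hasFDerivAt_err (d : Fin m → ℝ) (x : MultiPoint n) :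
    HasFDerivAt (fun x => err d (G.z x))
      (LinearMap.toContinuousLinearMap ((2 : ℝ) • G.R (G.z x)).mulVecLin) x := by
  rw [hasFDerivAt_pi']
  intro k
  have hz : ∀ c, HasFDerivAt (fun x => G.z x (k, c))
      (LinearMap.toContinuousLinearMap
        ((LinearMap.proj (k, c) : (Fin m × Fin 2 → ℝ) →ₗ[ℝ] ℝ) ∘ₗ G.Hbar.mulVecLin)) x :=
    fun c => (LinearMap.toContinuousLinearMap
        ((LinearMap.proj (k, c) : (Fin m × Fin 2 → ℝ) →ₗ[ℝ] ℝ) ∘ₗ G.Hbar.mulVecLin)).hasFDerivAt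
  have := (HasFDerivAt.fun_sum (u := Finset.univ) fun c _ => (hz c).pow 2).sub_const (d k ^ 2)
  refine this.congr_fderiv ?_
  ext h
  have h2 := G.R_mulVec (G.z x) h k
  simp only [Fin.sum_univ_two] at h2 ⊢
  have h4 : ∀ c, (G.Hbar *ᵥ h) (k, c) = G.z h (k, c) := fun c => rfl
  simp [h2, h4]
  ring

theorem hasFDerivAt_reducedErr (d : Fin m → ℝ) (T : Finset (Fin m)) (x : MultiPoint n) :
    HasFDerivAt (G.reducedErr d T)
      (LinearMap.toContinuousLinearMap ((2 : ℝ) • G.Rtilde T (G.z x)).mulVecLin) x := by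
  have h := (LinearMap.toContinuousLinearMap (Ptilde T).mulVecLin).hasFDerivAt.comp x
    (G.hasFDerivAt_err d x)
  refine (h.congr_fderiv ?_)
  ext h k
  simp [Rtilde]

end OrientedGraph

namespace OrientedGraph

variable (G : OrientedGraph n m)

/-! ### Minimal rigidity and infinitesimal motions -/

section Rigidity

/-- Spans of rows of the single matrix `R` make `T` and `T.erase k` comparable, although their
reduced matrices have different index types. -/
theorem rank_Rtilde (T : Finset (Fin m)) (z : Fin m × Fin 2 → ℝ) :
    (G.Rtilde T z).rank =
      Module.finrank ℝ (Submodule.span ℝ ((G.R z).row '' (T : Set (Fin m)))) := by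
  rw [Matrix.rank_eq_finrank_span_row]
  have : Set.range (G.Rtilde T z).row = (G.R z).row '' (T : Set (Fin m)) := by
    have hrow : ∀ k : {k // k ∈ T}, (G.Rtilde T z).row k = (G.R z).row k := fun k => by
      ext j
      exact G.Rtilde_apply T z k j
    ext v
    simp only [mem_range, mem_image, hrow]
    constructor
    · rintro ⟨k, rfl⟩
      exact ⟨k, k.2, rfl⟩
    · rintro ⟨k, hk, rfl⟩
      exact ⟨⟨k, hk⟩, rfl⟩
  rw [this]

/-- Minimal infinitesimal rigidity means that there are `2n - 3` edges, whose rows in the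
rigidity matrix are linearly independent. -/
theorem minInfRigid_iff (hn : 3 ≤ n) (T : Finset (Fin m)) (x : MultiPoint n) :
    G.MinInfRigid T x ↔
      T.card = 2 * n - 3 ∧ (G.Rtilde T (G.z x) * (G.Rtilde T (G.z x))ᵀ).det ≠ 0 := by
  constructor
  · rintro ⟨h1, h2⟩
    -- A row in the span of the others could be erased without loss of rank, against minimality.
    have hli : LinearIndepOn ℝ (G.R (G.z x)).row (T : Set (Fin m)) := by
      rw [linearIndepOn_iff_notMem_span]
      intro k hk hmem
      refine h2 k hk ?_
      have hT : (T : Set (Fin m)) = insert k ((T.erase k : Finset (Fin m)) : Set (Fin m)) := by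
        rw [← Finset.coe_insert, Finset.insert_erase hk]
      rw [← Finset.coe_erase] at hmem
      rw [InfRigid, rank_Rtilde] at h1 ⊢
      rw [← h1, hT, image_insert_eq, Submodule.span_insert_eq_span hmem]
    have hrow : LinearIndependent ℝ (G.Rtilde T (G.z x)).row := by
      have : (G.Rtilde T (G.z x)).row = fun k : (T : Set (Fin m)) => (G.R (G.z x)).row k := by
        ext k j
        exact G.Rtilde_apply T (G.z x) k j
      rw [this]
      exact hli
    refine ⟨?_, ?_⟩
    · have := hrow.rank_matrix
      rw [Fintype.card_coe] at this
      exact this.symm.trans h1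
    · have := Matrix.PosDef.mul_conjTranspose_self _ (Matrix.vecMul_injective_iff.2 hrow)
      rw [Matrix.conjTranspose_eq_transpose_of_trivial] at this
      exact this.det_pos.ne'
  · rintro ⟨h1, h2⟩
    refine ⟨?_, fun k hk h => ?_⟩
    · have h3 := Matrix.rank_of_isUnit _ ((Matrix.isUnit_iff_isUnit_det _).2 h2.isUnit)
      rw [Matrix.rank_self_mul_transpose, Fintype.card_coe] at h3
      exact h3.trans h1
    · have h3 := (G.Rtilde (T.erase k) (G.z x)).rank_le_card_height
      rw [Fintype.card_coe, Finset.card_erase_of_mem hk, h] at h3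
      omega

/-- An infinitesimal motion of a minimally rigid framework that fixes one end of an edge and the
direction of that edge vanishes. -/
theorem eq_zero_of_Rtilde_mulVec_eq_zero {T : Finset (Fin m)} {y : MultiPoint n}
    (hn : 3 ≤ n) (hT : G.InfRigid T y) {k : Fin m}
    (hk : G.z y (k, 0) ^ 2 + G.z y (k, 1) ^ 2 ≠ 0)
    {h : MultiPoint n} (hR : G.Rtilde T (G.z y) *ᵥ h = 0) (h0 : h (G.head k, 0) = 0)
    (h1 : h (G.head k, 1) = 0)
    (hc : G.z h (k, 0) * G.z y (k, 1) - G.z h (k, 1) * G.z y (k, 0) = 0) : h = 0 := by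
  set V := LinearMap.ker (G.Rtilde T (G.z y)).mulVecLin with hV
  -- Rank `2n - 3` leaves a kernel of dimension 3, so the three normalizing functionals `L` are
  -- injective on it once they are onto.
  have hdim : Module.finrank ℝ V = Module.finrank ℝ (Fin 3 → ℝ) := by
    have h2 := LinearMap.finrank_range_add_finrank_ker (G.Rtilde T (G.z y)).mulVecLin
    have h3 : Module.finrank ℝ (LinearMap.range (G.Rtilde T (G.z y)).mulVecLin) = 2 * n - 3 := hT
    rw [h3] at h2
    simp only [Module.finrank_fintype_fun_eq_card, Fintype.card_prod, Fintype.card_fin] at h2 ⊢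
    change _ + Module.finrank ℝ V = _ at h2
    omega
  let zl (c : Fin 2) : MultiPoint n →ₗ[ℝ] ℝ :=
    (LinearMap.proj (k, c) : (Fin m × Fin 2 → ℝ) →ₗ[ℝ] ℝ) ∘ₗ G.Hbar.mulVecLin
  let L : MultiPoint n →ₗ[ℝ] (Fin 3 → ℝ) := LinearMap.pi ![
    LinearMap.proj (G.head k, 0), LinearMap.proj (G.head k, 1),
    G.z y (k, 1) • zl 0 - G.z y (k, 0) • zl 1]
  have hL : ∀ w, L w = ![w (G.head k, 0), w (G.head k, 1),
      G.z y (k, 1) * G.z w (k, 0) - G.z y (k, 0) * G.z w (k, 1)] := by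
    intro w
    ext i
    fin_cases i <;> simp [L, zl, z]
  have hsurj : Function.Surjective (L ∘ₗ V.subtype) := by
    intro s
    -- The witness is a translation plus an infinitesimal rotation about the head of `k`; its rate
    -- `θ` is tuned to the third functional, which takes the value `-θ ‖z_k‖²`.
    set θ := -s 2 / (G.z y (k, 0) ^ 2 + G.z y (k, 1) ^ 2) with hθ
    let w : MultiPoint n := fun ic =>
      if ic.2 = 0 then s 0 - θ * (y (ic.1, 1) - y (G.head k, 1))
      else s 1 + θ * (y (ic.1, 0) - y (G.head k, 0))
    have hzw : ∀ l, G.z w (l, 0) = -θ * G.z y (l, 1) ∧ G.z w (l, 1) = θ * G.z y (l, 0) := by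
      intro l
      simp only [z_apply, w]
      constructor <;> simp <;> ring
    have hw : w ∈ V := by
      rw [hV, LinearMap.mem_ker, Matrix.mulVecLin_apply]
      ext l
      rw [Rtilde_mulVec, Fin.sum_univ_two, (hzw l).1, (hzw l).2, Pi.zero_apply]
      ring
    refine ⟨⟨w, hw⟩, ?_⟩
    rw [LinearMap.comp_apply, Submodule.subtype_apply, hL]
    ext i
    fin_cases i
    · simp [w]
    · simp [w]
    · simp only [(hzw k).1, (hzw k).2]
      have : θ * (G.z y (k, 0) ^ 2 + G.z y (k, 1) ^ 2) = -s 2 := by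
        rw [hθ]
        field_simp
      simp
      linarith
  have hinj := (LinearMap.injective_iff_surjective_of_finrank_eq_finrank hdim).2 hsurj
  have hmem : h ∈ V := by
    rw [hV, LinearMap.mem_ker]
    exact hR
  have : (L ∘ₗ V.subtype) ⟨h, hmem⟩ = (L ∘ₗ V.subtype) 0 := by
    rw [map_zero, LinearMap.comp_apply, Submodule.subtype_apply, hL]
    ext i
    fin_cases i
    · simp [h0]
    · simp [h1]
    · simp
      linarith
  simpa using congrArg Subtype.val (hinj this)

end Rigidity

/-! ### A slice transversal to the orbits -/

section Slice

/-- The position of a framework in its orbit at which the head of edge `k` is where it is in `y`,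
and edge `k` is parallel to that edge in `y`. -/
theorem exists_continuousAt_normalForm {k : Fin m} {y : MultiPoint n}
    (hk : G.z y (k, 0) ^ 2 + G.z y (k, 1) ^ 2 ≠ 0) :
    ∃ ν : MultiPoint n → MultiPoint n, ContinuousAt ν y ∧ ν y = y ∧ ∀ᶠ x in 𝓝 y,
      SameOrbit x (ν x) ∧ (∀ c, ν x (G.head k, c) = y (G.head k, c)) ∧
      G.z (ν x) (k, 0) * G.z y (k, 1) - G.z (ν x) (k, 1) * G.z y (k, 0) = 0 := by
  set u0 := G.z y (k, 0) with hu0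
  set u1 := G.z y (k, 1) with hu1
  have hcz : ∀ c, Continuous fun x : MultiPoint n => G.z x (k, c) := fun c =>
    (continuous_apply (k, c)).comp G.contDiff_z.continuous
  have hc0 := hcz 0
  have hc1 := hcz 1
  -- `N` is the product of the two edge lengths, so `P` and `Q` below are the cosine and sine of the
  -- angle from edge `k` in `x` to edge `k` in `y`.
  let N : MultiPoint n → ℝ := fun x =>
    √((G.z x (k, 0) ^ 2 + G.z x (k, 1) ^ 2) * (u0 ^ 2 + u1 ^ 2))
  have hupos : 0 < u0 ^ 2 + u1 ^ 2 := lt_of_le_of_ne (by positivity) (Ne.symm hk)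
  have hNc : Continuous N := by
    unfold N
    fun_prop
  have hNy : N y = u0 ^ 2 + u1 ^ 2 := Real.sqrt_mul_self hupos.le
  have hN0 : N y ≠ 0 := hNy ▸ hk
  let P : MultiPoint n → ℝ := fun x => (G.z x (k, 0) * u0 + G.z x (k, 1) * u1) / N x
  let Q : MultiPoint n → ℝ := fun x => (G.z x (k, 0) * u1 - G.z x (k, 1) * u0) / N x
  have hP : ContinuousAt P y := ContinuousAt.div (by fun_prop) hNc.continuousAt hN0
  have hQ : ContinuousAt Q y := ContinuousAt.div (by fun_prop) hNc.continuousAt hN0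
  have hPy : P y = 1 := by
    simp only [P, hNy, ← hu0, ← hu1]
    field_simp
  have hQy : Q y = 0 := by
    simp only [Q, ← hu0, ← hu1]
    ring
  refine ⟨fun x => move (P x) (Q x)
    (y (G.head k, 0) - (P x * x (G.head k, 0) - Q x * x (G.head k, 1)))
    (y (G.head k, 1) - (Q x * x (G.head k, 0) + P x * x (G.head k, 1))) x, ?_, ?_, ?_⟩
  · have hx : ∀ ic, ContinuousAt (fun x : MultiPoint n => x ic) y := fun ic =>
      (continuous_apply ic).continuousAt
    refine continuousAt_pi.2 fun ic => ?_
    unfold move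
    split_ifs
    · exact ((hP.mul (hx _)).sub (hQ.mul (hx _))).add
        (continuousAt_const.sub ((hP.mul (hx _)).sub (hQ.mul (hx _))))
    · exact ((hQ.mul (hx _)).add (hP.mul (hx _))).add
        (continuousAt_const.sub ((hQ.mul (hx _)).add (hP.mul (hx _))))
  · ext ⟨i, c⟩
    fin_cases c <;> simp [move, hPy, hQy]
  · filter_upwards [hNc.continuousAt.eventually_ne hN0] with x hx
    have hPQ : P x ^ 2 + Q x ^ 2 = 1 := by
      have hN2 : N x ^ 2 = (G.z x (k, 0) ^ 2 + G.z x (k, 1) ^ 2) * (u0 ^ 2 + u1 ^ 2) :=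
        Real.sq_sqrt (by positivity)
      simp only [P, Q, div_pow]
      rw [← add_div, div_eq_one_iff_eq (pow_ne_zero 2 hx), hN2]
      ring
    refine ⟨sameOrbit_iff_move.2 ⟨_, _, _, _, hPQ, rfl⟩, fun c => ?_, ?_⟩
    · fin_cases c <;> simp [move]
    · rw [(G.z_move _ _ _ _ x k).1, (G.z_move _ _ _ _ x k).2]
      simp only [P, Q]
      field_simp
      ring

/-- Near an infinitesimally rigid framework, frameworks with the same
reduced error that agree in the position of a vertex and the direction of an edge coincide. -/
theorem exists_ball_injOn_slice (hn : 3 ≤ n) (d : Fin m → ℝ) {T : Finset (Fin m)}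
    {y : MultiPoint n} (hT : G.InfRigid T y) {k : Fin m}
    (hk : G.z y (k, 0) ^ 2 + G.z y (k, 1) ^ 2 ≠ 0) :
    ∃ ρ > 0, InjOn (fun x => (G.reducedErr d T x, x (G.head k, 0), x (G.head k, 1),
      G.z x (k, 0) * G.z y (k, 1) - G.z x (k, 1) * G.z y (k, 0))) (Metric.ball y ρ) := by
  have hp : ∀ j : Fin n × Fin 2, HasFDerivAt (fun x : MultiPoint n => x j)
      (ContinuousLinearMap.proj j) y :=
    fun j => (ContinuousLinearMap.proj (R := ℝ) (φ := fun _ => ℝ) j).hasFDerivAt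
  have hz : ∀ c, HasFDerivAt (fun x : MultiPoint n => G.z x (k, c))
      (LinearMap.toContinuousLinearMap
        ((LinearMap.proj (k, c) : (Fin m × Fin 2 → ℝ) →ₗ[ℝ] ℝ) ∘ₗ G.Hbar.mulVecLin)) y :=
    fun c => (LinearMap.toContinuousLinearMap
        ((LinearMap.proj (k, c) : (Fin m × Fin 2 → ℝ) →ₗ[ℝ] ℝ) ∘ₗ G.Hbar.mulVecLin)).hasFDerivAt
  have hd := (G.hasFDerivAt_reducedErr d T y).prodMk ((hp (G.head k, 0)).prodMk
    ((hp (G.head k, 1)).prodMk (((hz 0).mul_const (G.z y (k, 1))).sub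
      ((hz 1).mul_const (G.z y (k, 0))))))
  have hsm : ContDiffAt ℝ ω (fun x => (G.reducedErr d T x, x (G.head k, 0), x (G.head k, 1),
      G.z x (k, 0) * G.z y (k, 1) - G.z x (k, 1) * G.z y (k, 0))) y := by
    have h1 := G.contDiff_reducedErr d T
    have h2 : ∀ c, ContDiff ℝ ω fun x : MultiPoint n => G.z x (k, c) := fun c =>
      contDiff_pi.1 G.contDiff_z (k, c)
    have h3 := h2 0
    have h4 := h2 1
    fun_prop
  refine exists_ball_injOn (hsm.hasStrictFDerivAt' hd (by simp)) fun v hv => ?_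
  simp only [ContinuousLinearMap.prod_apply, Prod.mk_eq_zero] at hv
  obtain ⟨hv1, hv2, hv3, hv4⟩ := hv
  refine G.eq_zero_of_Rtilde_mulVec_eq_zero hn hT hk ?_ hv2 hv3 ?_
  · simpa using hv1
  · simp at hv4
    simp only [z] at hv4 ⊢
    linarith

end Slice

/-! ### Existence of ambient spaces -/

theorem exists_isAmbientSpace (hn : 3 ≤ n) {d : Fin m → ℝ} {y : MultiPoint n}
    (hy : G.IsTarget d y) {T : Finset (Fin m)} (hT : G.MinInfRigid T y) :
    ∃ A, G.IsAmbientSpace d T y A := by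
  obtain ⟨hcard, hdet⟩ := (G.minInfRigid_iff hn T y).1 hT
  obtain ⟨k, -⟩ : T.Nonempty := by
    rw [← Finset.card_pos]
    omega
  have hk : G.z y (k, 0) ^ 2 + G.z y (k, 1) ^ 2 ≠ 0 := by
    have := hy.realizes k
    rw [Fin.sum_univ_two] at this
    rw [this]
    exact (pow_pos (hy.dist_pos k) 2).ne'
  obtain ⟨ν, hνc, hνy, hν⟩ := G.exists_continuousAt_normalForm hk
  obtain ⟨ρ, hρ, hinj⟩ := G.exists_ball_injOn_slice hn d hT.1 hk
  have hdetc : Continuous fun x : MultiPoint n =>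
      (G.Rtilde T (G.z x) * (G.Rtilde T (G.z x))ᵀ).det := by
    have hR := G.continuous_Rtilde T
    exact (hR.matrix_mul hR.matrix_transpose).matrix_det
  have hev : ∀ᶠ x in 𝓝 y, (SameOrbit x (ν x) ∧
      (∀ c, ν x (G.head k, c) = y (G.head k, c)) ∧
      G.z (ν x) (k, 0) * G.z y (k, 1) - G.z (ν x) (k, 1) * G.z y (k, 0) = 0) ∧
      ν x ∈ Metric.ball y ρ ∧ (G.Rtilde T (G.z x) * (G.Rtilde T (G.z x))ᵀ).det ≠ 0 := by
    refine hν.and (.and ?_ (hdetc.continuousAt.eventually_ne hdet))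
    refine hνc.eventually_mem ?_
    rw [hνy]
    exact Metric.ball_mem_nhds y hρ
  obtain ⟨U, hU, hUo, hyU⟩ := eventually_nhds_iff.1 hev
  -- Saturating `U` by orbits gives invariance. Two of its points with equal reduced error have
  -- normal forms in the slice and in the ball of injectivity, so these coincide and the points
  -- share an orbit.
  refine ⟨{x | ∃ p ∈ U, SameOrbit x p}, isOpen_orbits hUo, ⟨y, hyU, .refl y⟩, ?_, ?_, ?_⟩
  · rintro x ⟨p, hp, hxp⟩ x' hx'
    exact ⟨p, hp, hx'.symm.trans hxp⟩
  · rintro x ⟨p, hp, hxp⟩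
    rw [G.minInfRigid_iff hn, ← G.Rtilde_mul_Rtilde_transpose_eq T hxp]
    exact ⟨hcard, (hU p hp).2.2⟩
  · rintro x ⟨p, hp, hxp⟩ x' ⟨p', hp', hxp'⟩ he
    obtain ⟨⟨h1, h2, h3⟩, h4, -⟩ := hU p hp
    obtain ⟨⟨h1', h2', h3'⟩, h4', -⟩ := hU p' hp'
    have heq : ν p = ν p' := by
      refine hinj h4 h4' ?_
      simp only [h2, h2', h3, h3', Prod.mk.injEq, and_true]
      rw [G.reducedErr_eq h1, G.reducedErr_eq h1', G.reducedErr_eq hxp,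
        G.reducedErr_eq hxp', he]
    exact (hxp.trans h1).trans (heq ▸ (hxp'.trans h1').symm)

end OrientedGraph

namespace OrientedGraph

variable (G : OrientedGraph n m)

/-! ### Smoothness of the overall field -/

section Field

theorem overallField_apply (d μ : Fin m → ℝ) (x : MultiPoint n) (i : Fin n) (c : Fin 2) :
    G.overallField d μ x (i, c) = -(∑ k, G.H k i * G.z x (k, c) * err d (G.z x) k) +
      ∑ k, max (-G.H k i) 0 * G.z x (k, c) * μ k := by
  simp [overallField, Matrix.mulVec, dotProduct, R_apply, S_apply]

theorem contDiff_overallField (d : Fin m → ℝ) :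
    ContDiff ℝ ω (fun p : MultiPoint n × (Fin m → ℝ) => G.overallField d p.2 p.1) := by
  refine contDiff_pi.2 fun ⟨i, c⟩ => ?_
  simp only [overallField_apply]
  have h1 : ∀ k, ContDiff ℝ ω fun x : MultiPoint n => G.z x (k, c) := fun k =>
    contDiff_pi.1 G.contDiff_z (k, c)
  have h2 : ∀ k, ContDiff ℝ ω fun x : MultiPoint n => err d (G.z x) k := fun k =>
    contDiff_pi.1 ((contDiff_err d).comp G.contDiff_z) k
  refine (ContDiff.sum fun k _ => ?_).neg.add (ContDiff.sum fun k _ => ?_)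
  · exact (contDiff_const.mul ((h1 k).comp contDiff_fst)).mul ((h2 k).comp contDiff_fst)
  · exact (contDiff_const.mul ((h1 k).comp contDiff_fst)).mul
      (contDiff_pi.1 contDiff_snd k)

/-- On an ambient space twice this expression is `g`; composed with a smooth section it gives the
smoothness of `g`. -/
theorem contDiff_Rtilde_mulVec_overallField (d : Fin m → ℝ) (T : Finset (Fin m)) :
    ContDiff ℝ ω (fun p : MultiPoint n × (Fin m → ℝ) =>
      G.Rtilde T (G.z p.1) *ᵥ G.overallField d p.2 p.1) := by
  refine contDiff_pi.2 fun k => ?_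
  simp only [Rtilde_mulVec]
  have h1 : ∀ c, ContDiff ℝ ω fun x : MultiPoint n => G.z x (k, c) := fun c =>
    contDiff_pi.1 G.contDiff_z (k, c)
  refine ContDiff.sum fun c _ => ((h1 c).comp contDiff_fst).mul
    ((h1 c).comp (G.contDiff_overallField d))

end Field

/-! ### The error system on an ambient space -/

section Ambient

variable {G} {d : Fin m → ℝ} {T : Finset (Fin m)} {y : MultiPoint n} {A : Set (MultiPoint n)}

/-- The Jacobian matrix of the output map. -/
def outputJacobian (G : OrientedGraph n m) (d : Fin m → ℝ) (T : Finset (Fin m))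
    (A : Set (MultiPoint n)) (ε : {k // k ∈ T} → ℝ) : Matrix (Fin m) {k // k ∈ T} ℝ :=
  (Ptilde T)ᵀ + (Phat T)ᵀ * G.F d T A ε

theorem rep_mem {ε : {k // k ∈ T} → ℝ} (hε : ε ∈ G.reducedErr d T '' A) :
    G.rep d T A ε ∈ A ∧ G.reducedErr d T (G.rep d T A ε) = ε :=
  ⟨Function.invFunOn_mem hε, Function.invFunOn_eq hε⟩

theorem IsAmbientSpace.sameOrbit_rep (hA : G.IsAmbientSpace d T y A) {x : MultiPoint n}
    (hx : x ∈ A) : SameOrbit x (G.rep d T A (G.reducedErr d T x)) :=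
  have h := rep_mem (mem_image_of_mem _ hx)
  hA.orbit_eq _ hx _ h.1 h.2.symm

theorem IsAmbientSpace.psi_reducedErr (hA : G.IsAmbientSpace d T y A) {x : MultiPoint n}
    (hx : x ∈ A) : G.psi d T A (G.reducedErr d T x) = Phat T *ᵥ err d (G.z x) := by
  rw [psi, G.err_z_eq (hA.sameOrbit_rep hx)]

theorem IsAmbientSpace.output_reducedErr (hA : G.IsAmbientSpace d T y A) {x : MultiPoint n}
    (hx : x ∈ A) : G.output d T A (G.reducedErr d T x) = err d (G.z x) := by
  rw [output, hA.psi_reducedErr hx, reducedErr, Ptilde_Phat_decomp]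

theorem IsTarget.err_eq_zero (hy : G.IsTarget d y) : err d (G.z y) = 0 := by
  ext k
  simp [err, hy.realizes k]

theorem IsTarget.reducedErr_eq_zero (hy : G.IsTarget d y) : G.reducedErr d T y = 0 := by
  rw [reducedErr, hy.err_eq_zero, Matrix.mulVec_zero]

/-- The derivative `2R̃` has the right inverse `½ R̃'(R̃R̃')⁻¹`. Since `rep` is an arbitrary choice
without regularity, smoothness of `psi` and `g` is derived from `σ`. -/
theorem IsAmbientSpace.exists_section (hn : 3 ≤ n) (hA : G.IsAmbientSpace d T y A)
    {p : MultiPoint n} (hp : p ∈ A) :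
    ∃ σ : ({k // k ∈ T} → ℝ) → MultiPoint n, ContDiffAt ℝ ω σ (G.reducedErr d T p) ∧
      σ (G.reducedErr d T p) = p ∧
      ∀ᶠ ε in 𝓝 (G.reducedErr d T p), σ ε ∈ A ∧ G.reducedErr d T (σ ε) = ε := by
  have hdet := ((G.minInfRigid_iff hn T p).1 (hA.rigid p hp)).2
  set B := G.Rtilde T (G.z p) with hB
  obtain ⟨σ, h1, h2, h3⟩ := exists_contDiffAt_section
    (G.contDiff_reducedErr d T).contDiffAt (G.hasFDerivAt_reducedErr d T p)
    (LinearMap.toContinuousLinearMap ((2 : ℝ)⁻¹ • (Bᵀ * (B * Bᵀ)⁻¹)).mulVecLin) (fun w => by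
      have h : B * (Bᵀ * (B * Bᵀ)⁻¹) = 1 := by
        rw [← Matrix.mul_assoc, Matrix.mul_nonsing_inv _ hdet.isUnit]
      rw [LinearMap.coe_toContinuousLinearMap', LinearMap.coe_toContinuousLinearMap',
        Matrix.mulVecLin_apply, Matrix.mulVecLin_apply, Matrix.mulVec_mulVec, Matrix.smul_mul,
        Matrix.mul_smul, ← hB, h]
      simp)
  refine ⟨σ, h1, h2, .and ?_ h3⟩
  refine h1.continuousAt.eventually_mem ?_
  rw [h2]
  exact hA.isOpen.mem_nhds hp

theorem IsAmbientSpace.image_mem_nhds (hn : 3 ≤ n) (hA : G.IsAmbientSpace d T y A)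
    {p : MultiPoint n} (hp : p ∈ A) : G.reducedErr d T '' A ∈ 𝓝 (G.reducedErr d T p) := by
  obtain ⟨σ, -, -, h⟩ := hA.exists_section hn hp
  filter_upwards [h] with ε hε
  exact ⟨_, hε⟩

theorem IsAmbientSpace.contDiffAt_psi (hn : 3 ≤ n) (hA : G.IsAmbientSpace d T y A)
    {p : MultiPoint n} (hp : p ∈ A) : ContDiffAt ℝ ω (G.psi d T A) (G.reducedErr d T p) := by
  obtain ⟨σ, h1, h2, h3⟩ := hA.exists_section hn hp
  have h4 : ContDiffAt ℝ ω (fun ε => Phat T *ᵥ err d (G.z (σ ε))) (G.reducedErr d T p) :=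
    ((contDiff_mulVec _).comp ((contDiff_err d).comp G.contDiff_z)).contDiffAt.comp _ h1
  refine h4.congr_of_eventuallyEq ?_
  filter_upwards [h3] with ε hε
  rw [← hA.psi_reducedErr hε.1, hε.2]

theorem IsAmbientSpace.hasFDerivAt_output (hn : 3 ≤ n) (hA : G.IsAmbientSpace d T y A)
    {p : MultiPoint n} (hp : p ∈ A) : HasFDerivAt (G.output d T A)
      (LinearMap.toContinuousLinearMap
        (G.outputJacobian d T A (G.reducedErr d T p)).mulVecLin) (G.reducedErr d T p) := by
  have h1 := ((hA.contDiffAt_psi hn hp).differentiableAt (by simp)).hasFDerivAt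
  have h2 := (LinearMap.toContinuousLinearMap (Phat T)ᵀ.mulVecLin).hasFDerivAt.comp
    (G.reducedErr d T p) h1
  have h3 := (LinearMap.toContinuousLinearMap (Ptilde T)ᵀ.mulVecLin).hasFDerivAt
    (x := G.reducedErr d T p)
  refine (h3.add h2).congr_fderiv ?_
  have h4 : ∀ w, fderiv ℝ (G.psi d T A) (G.reducedErr d T p) w =
      G.F d T A (G.reducedErr d T p) *ᵥ w := by
    intro w
    rw [F, LinearMap.toMatrix'_mulVec]
    rfl
  refine ContinuousLinearMap.ext fun w => ?_
  simp [outputJacobian, h4]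

theorem IsAmbientSpace.contDiffAt_output (hn : 3 ≤ n) (hA : G.IsAmbientSpace d T y A)
    {p : MultiPoint n} (hp : p ∈ A) : ContDiffAt ℝ ω (G.output d T A) (G.reducedErr d T p) :=
  (contDiff_mulVec _).contDiffAt.add
    ((contDiff_mulVec _).contDiffAt.comp _ (hA.contDiffAt_psi hn hp))

/-- On the open set `A` the error is the output of the reduced error; the chain rule and uniqueness
of derivatives give `2R = Λ · 2R̃`. -/
theorem IsAmbientSpace.R_eq (hn : 3 ≤ n) (hA : G.IsAmbientSpace d T y A)
    {x : MultiPoint n} (hx : x ∈ A) :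
    G.R (G.z x) = G.outputJacobian d T A (G.reducedErr d T x) * G.Rtilde T (G.z x) := by
  have h1 := (hA.hasFDerivAt_output hn hx).comp x (G.hasFDerivAt_reducedErr d T x)
  have h2 : (G.output d T A ∘ G.reducedErr d T) =ᶠ[𝓝 x] fun x => err d (G.z x) := by
    filter_upwards [hA.isOpen.mem_nhds hx] with x' hx'
    exact hA.output_reducedErr hx'
  have h3 := (h1.congr_of_eventuallyEq h2.symm).unique (G.hasFDerivAt_err d x)
  refine Matrix.ext_of_mulVec_single fun j => ?_
  have h4 := congrArg (fun L => L (Pi.single j 1)) h3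
  simp only [ContinuousLinearMap.comp_apply, LinearMap.coe_toContinuousLinearMap',
    Matrix.mulVecLin_apply, Matrix.smul_mulVec, Matrix.mulVec_smul] at h4
  rw [← Matrix.mulVec_mulVec]
  exact (smul_right_injective _ (two_ne_zero (α := ℝ)) h4).symm

/-- Along trajectories of the overall system in the ambient space, the reduced error obeys the
error system. -/
theorem IsAmbientSpace.g_reducedErr (hn : 3 ≤ n) (hA : G.IsAmbientSpace d T y A)
    {x : MultiPoint n} (hx : x ∈ A) (μ : Fin m → ℝ) :
    G.g d T A (G.reducedErr d T x) μ =
      (2 : ℝ) • (G.Rtilde T (G.z x) *ᵥ G.overallField d μ x) := by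
  have hrep := hA.sameOrbit_rep hx
  have h1 : (G.R (G.z x))ᵀ *ᵥ err d (G.z x) = (G.Rtilde T (G.z x))ᵀ *ᵥ
      (G.reducedErr d T x + (G.F d T A (G.reducedErr d T x))ᵀ *ᵥ
        G.psi d T A (G.reducedErr d T x)) := by
    rw [hA.R_eq hn hx, Matrix.transpose_mul, ← Matrix.mulVec_mulVec, outputJacobian,
      Matrix.transpose_add, Matrix.transpose_mul, Matrix.transpose_transpose,
      Matrix.transpose_transpose, Matrix.add_mulVec, ← Matrix.mulVec_mulVec,
      hA.psi_reducedErr hx, ← reducedErr]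
  simp only [g, G.Rtilde_mul_Rtilde_transpose_eq T hrep, G.Rtilde_mul_S_transpose_eq T hrep,
    overallField, h1, Matrix.mulVec_add, Matrix.mulVec_neg, ← Matrix.mulVec_mulVec]
  module

/-- The ambient space is closed relative to the preimage of its image under the reduced error. -/
theorem IsAmbientSpace.mem_of_mem_closure (hn : 3 ≤ n) (hA : G.IsAmbientSpace d T y A)
    {x : MultiPoint n} (hx : x ∈ closure A) (hε : G.reducedErr d T x ∈ G.reducedErr d T '' A) :
    x ∈ A := by
  obtain ⟨p, hp, hpx⟩ := hε
  obtain ⟨σ, h1, h2, h3⟩ := hA.exists_section hn hp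
  obtain ⟨ρ, hρ, hball⟩ := Metric.isOpen_iff.1 hA.isOpen p hp
  have hred : Tendsto (G.reducedErr d T) (𝓝 x) (𝓝 (G.reducedErr d T p)) := by
    rw [hpx]
    exact (G.contDiff_reducedErr d T).continuous.continuousAt
  have hσ : Tendsto σ (𝓝 (G.reducedErr d T p)) (𝓝 p) := by
    simpa [h2] using h1.continuousAt.tendsto
  -- The motion taking a nearby `x' ∈ A` to its section point also takes `x` close to `p`: the
  -- distance is below `2 · ρ/4 + ρ/2 = ρ`. Hence the orbit of `x` meets `A`.
  have e1 := (hσ.comp hred).eventually (Metric.ball_mem_nhds p (half_pos hρ))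
  have e2 := hred.eventually h3
  have e3 := Metric.ball_mem_nhds x (show 0 < ρ / 4 by positivity)
  obtain ⟨x', ⟨⟨h4, h5⟩, h6⟩, h7⟩ :=
    mem_closure_iff_nhds.1 hx _ (inter_mem (inter_mem e1 e2) e3)
  obtain ⟨a, b, v, w, hab, hmove⟩ := sameOrbit_iff_move.1 (hA.orbit_eq x' h7 _ h5.1 h5.2.symm)
  have h8 : move a b v w x ∈ A := by
    refine hball ?_
    have h9 := norm_move_sub_le (a := v) (b := w) hab x x'
    rw [mem_ball_iff_norm] at h6 ⊢
    have h10 : ‖σ (G.reducedErr d T x') - p‖ < ρ / 2 := mem_ball_iff_norm.1 h4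
    rw [hmove] at h10
    have h11 := norm_add_le (move a b v w x - move a b v w x') (move a b v w x' - p)
    rw [sub_add_sub_cancel] at h11
    rw [norm_sub_rev] at h6
    linarith
  exact hA.invariant _ h8 _ (sameOrbit_iff_move.2 ⟨a, b, v, w, hab, rfl⟩).symm

theorem IsAmbientSpace.contDiffAt_g (hn : 3 ≤ n) (hA : G.IsAmbientSpace d T y A)
    {p : MultiPoint n} (hp : p ∈ A) (μ : Fin m → ℝ) :
    ContDiffAt ℝ ω (fun q : ({k // k ∈ T} → ℝ) × (Fin m → ℝ) => G.g d T A q.1 q.2)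
      (G.reducedErr d T p, μ) := by
  obtain ⟨σ, h1, h2, h3⟩ := hA.exists_section hn hp
  have h4 : ContDiffAt ℝ ω (fun q : ({k // k ∈ T} → ℝ) × (Fin m → ℝ) => (σ q.1, q.2))
      (G.reducedErr d T p, μ) :=
    (ContDiffAt.comp (G.reducedErr d T p, μ) (g := σ) h1 contDiffAt_fst).prodMk contDiffAt_snd
  have h5 := ((G.contDiff_Rtilde_mulVec_overallField d T).contDiffAt.comp _ h4).const_smul (2 : ℝ)
  refine h5.congr_of_eventuallyEq ?_
  filter_upwards [(continuousAt_fst (p := (G.reducedErr d T p, μ))).eventually h3] with q hq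
  simp only [Function.comp_apply]
  rw [← hA.g_reducedErr hn hq.1, hq.2]

/-- The linearization of the error system at the target formation. -/
theorem IsAmbientSpace.hasDerivAt_g (hn : 3 ≤ n) (hA : G.IsAmbientSpace d T y A)
    (hy : G.IsTarget d y) (w : {k // k ∈ T} → ℝ) :
    HasDerivAt (fun t : ℝ => G.g d T A (t • w) 0)
      ((-2 : ℝ) • (G.Rtilde T (G.z y) *ᵥ (G.Rtilde T (G.z y))ᵀ *ᵥ (G.outputJacobian d T A 0)ᵀ *ᵥ
        G.outputJacobian d T A 0 *ᵥ w)) 0 := by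
  obtain ⟨σ, h1, h2, h3⟩ := hA.exists_section hn hA.target_mem
  have hout := hA.hasFDerivAt_output hn hA.target_mem
  have hR := hA.R_eq hn hA.target_mem
  have hout0 := hA.output_reducedErr hA.target_mem
  rw [hy.reducedErr_eq_zero] at h1 h2 h3 hout hR hout0
  rw [hy.err_eq_zero] at hout0
  have hline : HasDerivAt (fun t : ℝ => t • w) w 0 := by
    simpa using (hasDerivAt_id (0 : ℝ)).smul_const w
  have hlc : Tendsto (fun t : ℝ => t • w) (𝓝 0) (𝓝 0) := by
    simpa using hline.continuousAt.tendsto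
  have hg : ∀ᶠ t : ℝ in 𝓝 0, G.g d T A (t • w) 0 =
      (-2 : ℝ) • ((G.Rtilde T (G.z (σ (t • w))) * (G.R (G.z (σ (t • w))))ᵀ) *ᵥ
        G.output d T A (t • w)) := by
    filter_upwards [hlc.eventually h3] with t ht
    have h4 := hA.g_reducedErr hn ht.1 0
    have h5 := hA.output_reducedErr ht.1
    rw [ht.2] at h4 h5
    rw [h4, h5, overallField, Matrix.mulVec_zero, add_zero, Matrix.mulVec_neg, Matrix.mulVec_mulVec]
    module
  have hov : HasDerivAt (fun t : ℝ => G.output d T A (t • w))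
      (G.outputJacobian d T A 0 *ᵥ w) 0 := by
    have h4 : HasFDerivAt (G.output d T A) (LinearMap.toContinuousLinearMap
        (G.outputJacobian d T A 0).mulVecLin) ((0 : ℝ) • w) := by rwa [zero_smul]
    exact h4.comp_hasDerivAt (0 : ℝ) hline
  -- The output vanishes at `0`, so the matrix factor need only be continuous: the difference
  -- quotient of the product is the matrix times that of the output.
  rw [hasDerivAt_iff_tendsto_slope_zero] at hov ⊢
  have hσ : Tendsto (fun t : ℝ => σ (t • w)) (𝓝[≠] 0) (𝓝 y) := by
    have := h1.continuousAt.tendsto.comp hlc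
    rw [h2] at this
    exact this.mono_left nhdsWithin_le_nhds
  have hmat : Tendsto (fun t : ℝ => G.Rtilde T (G.z (σ (t • w))) * (G.R (G.z (σ (t • w))))ᵀ)
      (𝓝[≠] 0) (𝓝 (G.Rtilde T (G.z y) * (G.R (G.z y))ᵀ)) :=
    (((G.continuous_Rtilde T).matrix_mul G.continuous_R.matrix_transpose).tendsto y).comp hσ
  have hmv : Continuous fun p : Matrix {k // k ∈ T} (Fin m) ℝ × (Fin m → ℝ) =>
      (-2 : ℝ) • (p.1 *ᵥ p.2) :=
    (continuous_fst.matrix_mulVec continuous_snd).fun_const_smul (-2 : ℝ)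
  have hlim := (hmv.tendsto (_, _)).comp (hmat.prodMk_nhds hov)
  have hval : (-2 : ℝ) • ((G.Rtilde T (G.z y) * (G.R (G.z y))ᵀ) *ᵥ
      (G.outputJacobian d T A 0 *ᵥ w)) = (-2 : ℝ) • (G.Rtilde T (G.z y) *ᵥ
        (G.Rtilde T (G.z y))ᵀ *ᵥ (G.outputJacobian d T A 0)ᵀ *ᵥ
        G.outputJacobian d T A 0 *ᵥ w) := by
    rw [hR, Matrix.transpose_mul]
    simp only [← Matrix.mulVec_mulVec]
  rw [← hval]
  refine hlim.congr' ?_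
  filter_upwards [nhdsWithin_le_nhds hg] with t ht
  have hg0 := hg.self_of_nhds
  simp only [zero_smul, hout0, Matrix.mulVec_zero, smul_zero] at hg0
  simp only [zero_add, zero_smul, hg0, sub_zero, ht, hout0, Function.comp_apply,
    Matrix.mulVec_smul]
  rw [smul_comm]

end Ambient

end OrientedGraph

/-- A smooth map that factors over a continuous linear map agrees with a bounded Lipschitz map
where that linear map is bounded by a given constant. -/
theorem exists_bounded_lipschitz_eq {E F : Type*} [NormedAddCommGroup E] [NormedSpace ℝ E]
    [NormedAddCommGroup F] [NormedSpace ℝ F] [FiniteDimensional ℝ F] {Φ : F → E}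
    (hΦ : ContDiff ℝ 1 Φ) (L : E →L[ℝ] F) (B : ℝ) :
    ∃ (h : E → E) (K C : NNReal), LipschitzWith K h ∧ (∀ x, ‖h x‖ ≤ C) ∧
      ∀ x, ‖L x‖ ≤ B → h x = Φ (L x) := by
  -- The absolute value keeps the radii positive even if `B` is negative.
  let χ : ContDiffBump (0 : F) := ⟨|B| + 1, |B| + 2, by positivity, by linarith⟩
  have hcs : HasCompactSupport fun z => χ z • Φ z := χ.hasCompactSupport.smul_right
  have hsm : ContDiff ℝ 1 fun z => χ z • Φ z := χ.contDiff.smul hΦ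
  obtain ⟨K, hK⟩ := hsm.lipschitzWith_of_hasCompactSupport hcs one_ne_zero
  obtain ⟨C, hC⟩ := hcs.exists_bound_of_continuous hsm.continuous
  refine ⟨fun x => χ (L x) • Φ (L x), K * ‖L‖₊, C.toNNReal, hK.comp L.lipschitz,
    fun x => (hC (L x)).trans (Real.le_coe_toNNReal C), fun x hx => ?_⟩
  have : χ (L x) = 1 := χ.one_of_mem_closedBall (by
    rw [mem_closedBall_zero_iff]
    exact hx.trans ((le_abs_self B).trans (by simp [χ])))
  simp only [this, one_smul]

theorem abs_dotProduct_le {ι : Type*} [Fintype ι] (u v : ι → ℝ) :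
    |u ⬝ᵥ v| ≤ Fintype.card ι * ‖u‖ * ‖v‖ := by
  refine (Finset.abs_sum_le_sum_abs _ _).trans ?_
  have : ∀ i ∈ (Finset.univ : Finset ι), |u i * v i| ≤ ‖u‖ * ‖v‖ := fun i _ => by
    rw [abs_mul]
    exact mul_le_mul (norm_le_pi_norm u i) (norm_le_pi_norm v i) (abs_nonneg _) (norm_nonneg _)
  refine (Finset.sum_le_sum this).trans ?_
  simp [mul_assoc]

/-! ### Linearization at the target and the equilibrium branch -/

namespace OrientedGraph

variable {G : OrientedGraph n m} {d : Fin m → ℝ} {T : Finset (Fin m)} {y : MultiPoint n}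
  {A : Set (MultiPoint n)}

/-- The overall field as a function of `z` alone: it can be cut off for large `z` while `x` stays
unbounded along its orbit. -/
theorem contDiff_edgeField (G : OrientedGraph n m) (d μ : Fin m → ℝ) :
    ContDiff ℝ 1 fun z => -((G.R z)ᵀ *ᵥ err d z) + (G.S z)ᵀ *ᵥ μ := by
  refine contDiff_pi.2 fun ⟨i, c⟩ => ?_
  simp only [Pi.add_apply, Pi.neg_apply, Matrix.mulVec, dotProduct, Matrix.transpose_apply,
    R_apply, S_apply, err]
  fun_prop

/-- The block of `Λ` at `T` is the identity, so `Λ` is injective and `Λ'Λ` is positive definite. -/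
theorem Ptilde_mulVec_outputJacobian_mulVec (w : {k // k ∈ T} → ℝ) (ε : {k // k ∈ T} → ℝ) :
    Ptilde T *ᵥ (G.outputJacobian d T A ε *ᵥ w) = w := by
  ext k
  rw [Ptilde_mulVec, outputJacobian, Matrix.add_mulVec, ← Matrix.mulVec_mulVec,
    Ptilde_transpose_mulVec_add, dif_pos k.2]

theorem outputJacobian_dotProduct_pos {w : {k // k ∈ T} → ℝ} (hw : w ≠ 0)
    (ε : {k // k ∈ T} → ℝ) :
    0 < (G.outputJacobian d T A ε *ᵥ w) ⬝ᵥ (G.outputJacobian d T A ε *ᵥ w) := by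
  refine lt_of_le_of_ne (Finset.sum_nonneg fun i _ => mul_self_nonneg _) fun h => hw ?_
  have h0 := dotProduct_self_eq_zero.1 h.symm
  rw [← Ptilde_mulVec_outputJacobian_mulVec (G := G) (d := d) (A := A) w ε, h0,
    Matrix.mulVec_zero]

/-- The linearization of the error system strictly decreases the squared norm of the output. -/
theorem IsAmbientSpace.linearization_dotProduct_pos (hn : 3 ≤ n) (hA : G.IsAmbientSpace d T y A)
    {w : {k // k ∈ T} → ℝ} (hw : w ≠ 0) :
    0 < ((G.outputJacobian d T A 0)ᵀ *ᵥ G.outputJacobian d T A 0 *ᵥ w) ⬝ᵥ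
      (G.Rtilde T (G.z y) *ᵥ (G.Rtilde T (G.z y))ᵀ *ᵥ (G.outputJacobian d T A 0)ᵀ *ᵥ
        G.outputJacobian d T A 0 *ᵥ w) := by
  have hdet := ((G.minInfRigid_iff hn T y).1 (hA.rigid y hA.target_mem)).2
  have hpos := outputJacobian_dotProduct_pos (G := G) (d := d) (A := A) hw 0
  set Λ := G.outputJacobian d T A 0
  set B := G.Rtilde T (G.z y)
  set v := Λᵀ *ᵥ Λ *ᵥ w with hv
  have h1 : v ⬝ᵥ (B *ᵥ Bᵀ *ᵥ v) = (Bᵀ *ᵥ v) ⬝ᵥ (Bᵀ *ᵥ v) := by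
    rw [Matrix.dotProduct_mulVec, Matrix.mulVec_transpose]
  rw [h1]
  refine lt_of_le_of_ne (Finset.sum_nonneg fun i _ => mul_self_nonneg _) fun h => ?_
  have h0 : Bᵀ *ᵥ v = 0 := dotProduct_self_eq_zero.1 h.symm
  have h2 : v = 0 := by
    by_contra hne
    refine hdet (Matrix.exists_mulVec_eq_zero_iff.1 ⟨v, hne, ?_⟩)
    rw [← Matrix.mulVec_mulVec, h0, Matrix.mulVec_zero]
  have h3 : w ⬝ᵥ v = (Λ *ᵥ w) ⬝ᵥ (Λ *ᵥ w) := by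
    rw [hv, Matrix.dotProduct_mulVec, Matrix.vecMul_transpose]
  rw [← h3, h2, dotProduct_zero] at hpos
  exact lt_irrefl _ hpos

/-- The error system is smooth near the target, with the expected linearization. -/
theorem IsAmbientSpace.exists_hasStrictFDerivAt_g (hn : 3 ≤ n) (hA : G.IsAmbientSpace d T y A)
    (hy : G.IsTarget d y) :
    ContDiffAt ℝ ω (fun q : ({k // k ∈ T} → ℝ) × (Fin m → ℝ) => G.g d T A q.1 q.2) (0, 0) ∧
    ∃ g' : (({k // k ∈ T} → ℝ) × (Fin m → ℝ)) →L[ℝ] ({k // k ∈ T} → ℝ),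
      HasStrictFDerivAt (fun q : ({k // k ∈ T} → ℝ) × (Fin m → ℝ) => G.g d T A q.1 q.2)
        g' (0, 0) ∧
      ∀ w, g' (w, 0) = (-2 : ℝ) • (G.Rtilde T (G.z y) *ᵥ (G.Rtilde T (G.z y))ᵀ *ᵥ
        (G.outputJacobian d T A 0)ᵀ *ᵥ G.outputJacobian d T A 0 *ᵥ w) := by
  have hsm := hA.contDiffAt_g hn hA.target_mem 0
  rw [hy.reducedErr_eq_zero] at hsm
  have hstrict := hsm.hasStrictFDerivAt (by simp)
  refine ⟨hsm, _, hstrict, fun w => ?_⟩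
  have hline : HasDerivAt (fun t : ℝ => (t • w, (0 : Fin m → ℝ))) (w, 0) 0 := by
    have : HasDerivAt (fun t : ℝ => t • w) w 0 := by
      simpa using (hasDerivAt_id (0 : ℝ)).smul_const w
    exact this.prodMk (hasDerivAt_const _ _)
  have h0 : HasFDerivAt (fun q : ({k // k ∈ T} → ℝ) × (Fin m → ℝ) => G.g d T A q.1 q.2)
      (fderiv ℝ (fun q : ({k // k ∈ T} → ℝ) × (Fin m → ℝ) => G.g d T A q.1 q.2) (0, 0))
      ((0 : ℝ) • w, 0) := by
    rw [zero_smul]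
    exact hstrict.hasFDerivAt
  have h1 := h0.comp_hasDerivAt (0 : ℝ) hline
  exact h1.unique (hA.hasDerivAt_g hn hy w)

theorem IsAmbientSpace.g_zero (hn : 3 ≤ n) (hA : G.IsAmbientSpace d T y A)
    (hy : G.IsTarget d y) : G.g d T A 0 0 = 0 := by
  have := hA.g_reducedErr hn hA.target_mem 0
  rw [hy.reducedErr_eq_zero] at this
  rw [this, overallField, hy.err_eq_zero]
  simp

/-- This is the implicit function theorem: a local section `σ` of `(ε, μ) ↦ (g(ε, μ), μ)` gives
`ε_μ` as the first component of `σ(0, μ)`. -/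
theorem IsAmbientSpace.exists_isEquilibriumBranch (hn : 3 ≤ n) (hA : G.IsAmbientSpace d T y A)
    (hy : G.IsTarget d y) : ∃ M ε, G.IsEquilibriumBranch d T A M ε := by
  obtain ⟨hsm, g', hg', hlin⟩ := hA.exists_hasStrictFDerivAt_g hn hy
  let L : ({k // k ∈ T} → ℝ) →ₗ[ℝ] ({k // k ∈ T} → ℝ) :=
    g'.toLinearMap ∘ₗ LinearMap.inl ℝ _ _
  have hL : ∀ w, L w = g' (w, 0) := fun w => rfl
  have hinj : Function.Injective L := by
    refine (injective_iff_map_eq_zero L).2 fun w hw => ?_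
    by_contra hne
    have h1 := hA.linearization_dotProduct_pos hn hne
    rw [hL, hlin, smul_eq_zero] at hw
    rw [hw.resolve_left (by norm_num), dotProduct_zero] at h1
    exact lt_irrefl _ h1
  let Le := (LinearEquiv.ofInjectiveEndo L hinj).toContinuousLinearEquiv
  have hLe : ∀ w, g' (Le.symm w, 0) = w := fun w => Le.apply_symm_apply w
  -- The right inverse sends `(a, b)` to `(L⁻¹(a - g'(0, b)), b)`.
  let r : (({k // k ∈ T} → ℝ) × (Fin m → ℝ)) →L[ℝ] (({k // k ∈ T} → ℝ) × (Fin m → ℝ)) :=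
    ((Le.symm : _ →L[ℝ] _).comp (ContinuousLinearMap.fst ℝ _ _ -
      g'.comp ((ContinuousLinearMap.inr ℝ _ _).comp (ContinuousLinearMap.snd ℝ _ _)))).prod
      (ContinuousLinearMap.snd ℝ _ _)
  obtain ⟨σ, h1, h2, h3⟩ := exists_contDiffAt_section (hsm.prodMk contDiffAt_snd)
    (hg'.hasFDerivAt.prodMk hasFDerivAt_snd) r (by
      rintro ⟨a, b⟩
      have hsplit : ∀ (u : {k // k ∈ T} → ℝ), g' (u, b) = g' (u, 0) + g' (0, b) := fun u => by
        rw [← map_add]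
        simp
      simp only [r, ContinuousLinearMap.prod_apply, ContinuousLinearMap.comp_apply,
        ContinuousLinearEquiv.coe_coe, sub_apply,
        ContinuousLinearMap.coe_fst', ContinuousLinearMap.coe_snd',
        ContinuousLinearMap.inr_apply]
      rw [hsplit, hLe]
      simp)
  simp only [hA.g_zero hn hy] at h1 h2 h3
  have hμ : ContDiff ℝ ω fun μ : Fin m → ℝ => ((0 : {k // k ∈ T} → ℝ), μ) := by fun_prop
  have hε : ContDiffAt ℝ ω (fun μ : Fin m → ℝ => (σ (0, μ)).1) 0 :=
    contDiffAt_fst.comp _ (ContDiffAt.comp (0 : Fin m → ℝ) h1 hμ.contDiffAt)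
  have hnhds : G.reducedErr d T '' A ∈ 𝓝 ((σ (0, 0)).1) := by
    have := hA.image_mem_nhds hn hA.target_mem
    rw [hy.reducedErr_eq_zero] at this
    rwa [h2]
  have hev : ∀ᶠ μ : Fin m → ℝ in 𝓝 0, ContDiffAt ℝ ω (fun μ : Fin m → ℝ => (σ (0, μ)).1) μ ∧
      (σ (0, μ)).1 ∈ G.reducedErr d T '' A ∧ G.g d T A (σ (0, μ)).1 μ = 0 := by
    -- Order `ω` at a point spreads to a neighbourhood, which `ContDiffAt ℝ ∞` need not do.
    refine (hε.eventually (by simp)).and ((hε.continuousAt.eventually_mem hnhds).and ?_)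
    filter_upwards [hμ.continuous.continuousAt.eventually h3] with μ hμ'
    rw [Prod.mk.injEq] at hμ'
    have := hμ'.1
    rwa [hμ'.2] at this
  obtain ⟨M, hM, hMo, hM0⟩ := eventually_nhds_iff.1 hev
  exact ⟨M, fun μ => (σ (0, μ)).1, hMo, hM0,
    fun μ h => ((hM μ h).1.of_le le_top).contDiffWithinAt, by simp [h2],
    fun μ h => (hM μ h).2.1, fun μ h => (hM μ h).2.2⟩

end OrientedGraph

/-! ### Lyapunov function and exponential convergence -/

namespace OrientedGraph

variable {G : OrientedGraph n m} {d : Fin m → ℝ} {T : Finset (Fin m)} {y : MultiPoint n}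
  {A : Set (MultiPoint n)}

/-- The squared Euclidean norm of the linearized output, a quadratic Lyapunov function of the
error system. -/
def lyapunov (G : OrientedGraph n m) (d : Fin m → ℝ) (T : Finset (Fin m))
    (A : Set (MultiPoint n)) (w : {k // k ∈ T} → ℝ) : ℝ :=
  (G.outputJacobian d T A 0 *ᵥ w) ⬝ᵥ (G.outputJacobian d T A 0 *ᵥ w)

theorem continuous_lyapunov : Continuous (G.lyapunov d T A) := by
  unfold lyapunov
  have : Continuous fun w : {k // k ∈ T} → ℝ => G.outputJacobian d T A 0 *ᵥ w :=
    (contDiff_mulVec _).continuous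
  exact this.dotProduct this

theorem lyapunov_nonneg (w : {k // k ∈ T} → ℝ) : 0 ≤ G.lyapunov d T A w := by
  unfold lyapunov
  exact Finset.sum_nonneg fun i _ => mul_self_nonneg _

theorem lyapunov_bounds : ∃ a > 0, ∃ b > 0, ∀ w,
    a * ‖w‖ ^ 2 ≤ G.lyapunov d T A w ∧ G.lyapunov d T A w ≤ b * ‖w‖ ^ 2 := by
  refine exists_sq_norm_bounds continuous_lyapunov (fun t w => ?_) fun w hw =>
    outputJacobian_dotProduct_pos hw 0
  simp only [lyapunov, Matrix.mulVec_smul, smul_dotProduct, dotProduct_smul, smul_eq_mul]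
  ring

theorem hasDerivWithinAt_lyapunov {w : ℝ → {k // k ∈ T} → ℝ} {w' : {k // k ∈ T} → ℝ}
    {s : Set ℝ} {t : ℝ} (h : HasDerivWithinAt w w' s t) :
    HasDerivWithinAt (fun t => G.lyapunov d T A (w t))
      (2 * (((G.outputJacobian d T A 0)ᵀ *ᵥ G.outputJacobian d T A 0 *ᵥ w t) ⬝ᵥ w')) s t := by
  set Λ := G.outputJacobian d T A 0 with hΛ
  have h1 : HasDerivWithinAt (fun t => Λ *ᵥ w t) (Λ *ᵥ w') s t :=
    (LinearMap.toContinuousLinearMap Λ.mulVecLin).hasFDerivAt.comp_hasDerivWithinAt t h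
  have h2 := hasDerivWithinAt_pi.1 h1
  have h3 := HasDerivWithinAt.fun_sum (u := Finset.univ) fun k _ => (h2 k).mul (h2 k)
  have h4 : (Λᵀ *ᵥ Λ *ᵥ w t) ⬝ᵥ w' = (Λ *ᵥ w t) ⬝ᵥ (Λ *ᵥ w') := by
    rw [Matrix.dotProduct_mulVec, Matrix.mulVec_transpose]
  refine h3.congr_deriv ?_
  rw [h4]
  simp only [dotProduct, Finset.mul_sum]
  exact Finset.sum_congr rfl fun k _ => by ring

/-- The Lyapunov function decreases at a uniform rate along the error systems, with respect to
equilibria near the target. -/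
theorem IsAmbientSpace.exists_lyapunov_decrease (hn : 3 ≤ n) (hA : G.IsAmbientSpace d T y A)
    (hy : G.IsTarget d y) :
    ∃ c > 0, ∃ s > 0, ∀ (ε ε' : {k // k ∈ T} → ℝ) (μ : Fin m → ℝ), ‖ε‖ < s → ‖ε'‖ < s → ‖μ‖ < s →
      G.g d T A ε' μ = 0 →
      ((G.outputJacobian d T A 0)ᵀ *ᵥ G.outputJacobian d T A 0 *ᵥ (ε - ε')) ⬝ᵥ G.g d T A ε μ ≤
        -c * ‖ε - ε'‖ ^ 2 := by
  obtain ⟨-, g', hg', hlin⟩ := hA.exists_hasStrictFDerivAt_g hn hy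
  set Λ := G.outputJacobian d T A 0
  let K : ({k // k ∈ T} → ℝ) →L[ℝ] ({k // k ∈ T} → ℝ) :=
    LinearMap.toContinuousLinearMap (Λᵀ.mulVecLin ∘ₗ Λ.mulVecLin)
  have hK : ∀ w, K w = Λᵀ *ᵥ Λ *ᵥ w := fun w => rfl
  let g₁ : ({k // k ∈ T} → ℝ) →L[ℝ] ({k // k ∈ T} → ℝ) :=
    g'.comp (ContinuousLinearMap.inl ℝ _ _)
  have hg₁ : ∀ w, g₁ w = g' (w, 0) := fun w => rfl
  obtain ⟨a, ha, _, _, hab⟩ := exists_sq_norm_bounds (q := fun w => -(K w ⬝ᵥ g₁ w))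
    (K.continuous.dotProduct g₁.continuous).neg
    (fun t w => by
      simp only [map_smul, smul_dotProduct, dotProduct_smul, smul_eq_mul]
      ring)
    (fun w hw => by
      have := hA.linearization_dotProduct_pos hn hw
      rw [hg₁, hlin, hK, dotProduct_smul, smul_eq_mul]
      linarith)
  set C : ℝ := Fintype.card {k // k ∈ T} * ‖K‖ with hC
  have hC0 : 0 ≤ C := by positivity
  -- The nonlinear remainder may cost at most half of the decrease `a`; the `+ 1` avoids division by
  -- zero.
  have hlo := hg'.isLittleO.def (show (0 : ℝ) < a / 2 / (C + 1) by positivity)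
  obtain ⟨s, hs, hball⟩ := Metric.eventually_nhds_iff_ball.1 hlo
  refine ⟨a / 2, by positivity, s, hs, fun ε ε' μ h1 h2 h3 h4 => ?_⟩
  -- Both points carry the same `μ`, so their difference is `(ε - ε', 0)` and only the `ε`-part of
  -- the linearization enters.
  have h5 := hball ((ε, μ), (ε', μ)) (by
    simp only [mem_ball_iff_norm, Prod.mk_sub_mk, sub_zero, Prod.norm_mk, sup_lt_iff]
    exact ⟨⟨h1, h3⟩, h2, h3⟩)
  simp only [h4, sub_zero, Prod.mk_sub_mk, sub_self, Prod.norm_mk, norm_zero] at h5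
  rw [max_eq_left (norm_nonneg _), ← hg₁] at h5
  set w := ε - ε' with hw
  have h6 : K w ⬝ᵥ G.g d T A ε μ = K w ⬝ᵥ g₁ w + K w ⬝ᵥ (G.g d T A ε μ - g₁ w) := by
    rw [← dotProduct_add, add_sub_cancel]
  rw [← hK, h6]
  have h7 := (hab w).1
  have h8 : K w ⬝ᵥ (G.g d T A ε μ - g₁ w) ≤ a / 2 * ‖w‖ ^ 2 := by
    refine (le_abs_self _).trans ((abs_dotProduct_le _ _).trans ?_)
    calc Fintype.card {k // k ∈ T} * ‖K w‖ * ‖G.g d T A ε μ - g₁ w‖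
        ≤ Fintype.card {k // k ∈ T} * (‖K‖ * ‖w‖) * (a / 2 / (C + 1) * ‖w‖) := by
          gcongr
          exact K.le_opNorm w
      _ = C / (C + 1) * (a / 2 * ‖w‖ ^ 2) := by
          rw [hC]
          field_simp
      _ ≤ 1 * (a / 2 * ‖w‖ ^ 2) := by
          gcongr
          rw [div_le_one (by positivity)]
          linarith
      _ = _ := one_mul _
  linarith

/-- A curve of multi-points that follows the overall system as long as it is in the ambient space
and its reduced error is in a sublevel set of the Lyapunov function stays there, and the Lyapunov
function decays exponentially along it. -/
theorem IsAmbientSpace.forall_mem_and_lyapunov_le (hn : 3 ≤ n) (hA : G.IsAmbientSpace d T y A)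
    {μ : Fin m → ℝ} {ε₀ : {k // k ∈ T} → ℝ} {η ρ : ℝ} (hρ : 0 ≤ ρ)
    (hsub : ∀ ε, G.lyapunov d T A (ε - ε₀) < η → ε ∈ G.reducedErr d T '' A)
    (hdec : ∀ ε, G.lyapunov d T A (ε - ε₀) < η →
      2 * (((G.outputJacobian d T A 0)ᵀ *ᵥ G.outputJacobian d T A 0 *ᵥ (ε - ε₀)) ⬝ᵥ
        G.g d T A ε μ) ≤ -ρ * G.lyapunov d T A (ε - ε₀))
    {h : MultiPoint n → MultiPoint n}
    (hh : ∀ x ∈ A, G.lyapunov d T A (G.reducedErr d T x - ε₀) < η → h x = G.overallField d μ x)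
    {x : ℝ → MultiPoint n} (hx : ∀ t, 0 ≤ t → HasDerivWithinAt x (h (x t)) (Ici 0) t)
    (hx0 : x 0 ∈ A) (hV0 : G.lyapunov d T A (G.reducedErr d T (x 0) - ε₀) < η) :
    ∀ t, 0 ≤ t → (x t ∈ A ∧ G.lyapunov d T A (G.reducedErr d T (x t) - ε₀) < η) ∧
      G.lyapunov d T A (G.reducedErr d T (x t) - ε₀) ≤
        G.lyapunov d T A (G.reducedErr d T (x 0) - ε₀) * Real.exp (-ρ * t) := by
  set V : ℝ → ℝ := fun t => G.lyapunov d T A (G.reducedErr d T (x t) - ε₀) with hV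
  have hxc : ContinuousOn x (Ici 0) := fun t ht => (hx t ht).continuousWithinAt
  have hLc : Continuous fun p => G.lyapunov d T A (G.reducedErr d T p - ε₀) :=
    continuous_lyapunov.comp ((G.contDiff_reducedErr d T).continuous.sub continuous_const)
  have hdecay : ∀ b, (∀ t, 0 ≤ t → t < b →
      x t ∈ A ∧ G.lyapunov d T A (G.reducedErr d T (x t) - ε₀) < η) →
      ∀ t ∈ Icc 0 b, V t ≤ V 0 * Real.exp (-ρ * t) := by
    intro b hb
    refine le_mul_exp_of_deriv_le (V' := fun t =>
      2 * (((G.outputJacobian d T A 0)ᵀ *ᵥ G.outputJacobian d T A 0 *ᵥ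
        (G.reducedErr d T (x t) - ε₀)) ⬝ᵥ G.g d T A (G.reducedErr d T (x t)) μ)) ?_ ?_ ?_
    · exact hLc.comp_continuousOn (hxc.mono Icc_subset_Ici_self)
    · rintro t ⟨ht0, htb⟩
      obtain ⟨h1, h2⟩ := hb t ht0 htb
      have h3 : HasDerivWithinAt x (G.overallField d μ (x t)) (Ici t) t := by
        rw [← hh _ h1 h2]
        exact (hx t ht0).mono (Ici_subset_Ici.2 ht0)
      have h4 := (G.hasFDerivAt_reducedErr d T (x t)).comp_hasDerivWithinAt t h3
      refine hasDerivWithinAt_lyapunov ?_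
      rw [hA.g_reducedErr hn h1]
      refine (h4.sub_const ε₀).congr_deriv ?_
      simp
    · rintro t ⟨ht0, htb⟩
      exact hdec _ (hb t ht0 htb).2
  have hmem : ∀ t, 0 ≤ t → x t ∈ {p | p ∈ A ∧
      G.lyapunov d T A (G.reducedErr d T p - ε₀) < η} := by
    refine forall_mem_of_forall_lt (hA.isOpen.inter (isOpen_lt hLc continuous_const)) hxc ?_
    intro b hb hlt
    rcases hb.eq_or_lt with rfl | hb'
    · exact ⟨hx0, hV0⟩
    · have h1 := hdecay b hlt b ⟨hb, le_rfl⟩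
      have h2 : V b < η := by
        refine h1.trans_lt (lt_of_le_of_lt ?_ hV0)
        refine mul_le_of_le_one_right ?_ (Real.exp_le_one_iff.2 ?_)
        · exact lyapunov_nonneg _
        · nlinarith
      -- At time `b` the point is a limit of points of `A`, and its reduced error is in the image of
      -- `A` by the decay of `V`.
      refine ⟨hA.mem_of_mem_closure hn ?_ (hsub _ h2), h2⟩
      refine ((hxc b hb).mono (fun t ht => ht.1 : Ico 0 b ⊆ Ici 0)).mem_closure
        ?_ fun t ht => (hlt t ht.1 ht.2).1
      rw [closure_Ico hb'.ne]
      exact ⟨hb, le_rfl⟩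
  exact fun t ht => ⟨hmem t ht, hdecay t (fun s hs _ => hmem s hs) t ⟨ht, le_rfl⟩⟩

/-- Where the error is bounded by a given constant, the field of the overall system agrees with a
bounded Lipschitz field. -/
theorem exists_truncatedField (G : OrientedGraph n m) (d μ : Fin m → ℝ) (C : ℝ) :
    ∃ (h : MultiPoint n → MultiPoint n) (K L : NNReal), LipschitzWith K h ∧ (∀ x, ‖h x‖ ≤ L) ∧
      ∀ x, ‖err d (G.z x)‖ ≤ C → h x = G.overallField d μ x := by
  -- Each coordinate satisfies `|z| ≤ z² + 1` and `z² ≤ C + ‖d‖²`, hence the bound.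
  obtain ⟨h, K, L, h1, h2, h3⟩ := exists_bounded_lipschitz_eq (contDiff_edgeField G d μ)
    (LinearMap.toContinuousLinearMap G.Hbar.mulVecLin) (C + ‖d‖ ^ 2 + 1)
  refine ⟨h, K, L, h1, h2, fun x hx => h3 x ?_⟩
  have hC : 0 ≤ C := (norm_nonneg _).trans hx
  change ‖G.z x‖ ≤ _
  refine (pi_norm_le_iff_of_nonneg (by positivity)).2 fun ⟨k, c⟩ => ?_
  have e1 : err d (G.z x) k ≤ C := (le_abs_self _).trans ((norm_le_pi_norm _ k).trans hx)
  have e2 : |d k| ≤ ‖d‖ := norm_le_pi_norm d k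
  have e3 : d k ^ 2 ≤ ‖d‖ ^ 2 := sq_le_sq.2 (by rwa [abs_norm])
  have e4 : G.z x (k, c) ^ 2 ≤ ∑ c, G.z x (k, c) ^ 2 :=
    Finset.single_le_sum (f := fun c => G.z x (k, c) ^ 2) (fun _ _ => sq_nonneg _)
      (Finset.mem_univ c)
  have e5 : ∑ c, G.z x (k, c) ^ 2 = err d (G.z x) k + d k ^ 2 := by simp [err]
  rw [Real.norm_eq_abs]
  nlinarith [sq_abs (G.z x (k, c)), sq_nonneg (|G.z x (k, c)| - 1), abs_nonneg (G.z x (k, c))]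

/-- Trajectories of the overall system that start near the equilibrium output exist for all times,
stay in the ambient space, and their errors converge exponentially. -/
theorem IsAmbientSpace.exists_nhds_exponential_convergence (hn : 3 ≤ n)
    (hA : G.IsAmbientSpace d T y A) (hy : G.IsTarget d y) :
    ∃ s > 0, ∀ (μ : Fin m → ℝ) (ε₀ : {k // k ∈ T} → ℝ), ‖μ‖ < s → ‖ε₀‖ < s →
      G.g d T A ε₀ μ = 0 →
      ∃ δ > 0, ∃ c > 0, ∃ r > 0, ∀ x₀ ∈ A,
        ‖err d (G.z x₀) - G.output d T A ε₀‖ < δ →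
          (∃ x, G.IsTrajectory d μ x₀ x) ∧
          ∀ x, G.IsTrajectory d μ x₀ x → (∀ t, 0 ≤ t → x t ∈ A) ∧
            ∀ t, 0 ≤ t → ‖err d (G.z (x t)) - G.output d T A ε₀‖ ≤ c * Real.exp (-r * t) := by
  obtain ⟨a, ha, b, hb, hab⟩ := lyapunov_bounds (G := G) (d := d) (T := T) (A := A)
  obtain ⟨c, hc, s₁, hs₁, hdec⟩ := hA.exists_lyapunov_decrease hn hy
  have hnhds := hA.image_mem_nhds hn hA.target_mem
  have hout := hA.contDiffAt_output hn hA.target_mem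
  rw [hy.reducedErr_eq_zero] at hnhds hout
  obtain ⟨Lo, u, hu, hLo⟩ := (hout.of_le (m := 1) le_top).exists_lipschitzOnWith
  obtain ⟨s₂, hs₂, hball⟩ := Metric.mem_nhds_iff.1 (inter_mem hnhds hu)
  set s := min s₁ s₂ with hs
  have hs0 : 0 < s := lt_min hs₁ hs₂
  refine ⟨s / 2, half_pos hs0, fun μ ε₀ hμ hε₀ hg => ?_⟩
  -- The sublevel set `V(ε - ε₀) < η` lies in the ball of radius `s / 2` about `ε₀`, hence in the
  -- ball of radius `s` about `0`, where all local estimates hold.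
  set η := a * (s / 2) ^ 2 with hη
  have hη0 : 0 < η := by positivity
  have hsmall : ∀ ε, G.lyapunov d T A (ε - ε₀) < η → ‖ε‖ < s := by
    intro ε hε
    have h1 := (hab (ε - ε₀)).1.trans_lt hε
    have h2 : ‖ε - ε₀‖ < s / 2 :=
      lt_of_pow_lt_pow_left₀ 2 (half_pos hs0).le (lt_of_mul_lt_mul_left h1 ha.le)
    have h3 := norm_add_le (ε - ε₀) ε₀
    rw [sub_add_cancel] at h3
    linarith
  have hin : ∀ ε, ‖ε‖ < s → ε ∈ G.reducedErr d T '' A ∩ u := fun ε hε =>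
    hball (mem_ball_zero_iff.2 (hε.trans_le (min_le_right _ _)))
  have hε₀s : ‖ε₀‖ < s := by linarith
  have hlip : ∀ ε, ‖ε‖ < s →
      ‖G.output d T A ε - G.output d T A ε₀‖ ≤ Lo * ‖ε - ε₀‖ := fun ε hε =>
    hLo.norm_sub_le (hin ε hε).2 (hin ε₀ hε₀s).2
  have hdec' : ∀ ε, G.lyapunov d T A (ε - ε₀) < η →
      2 * (((G.outputJacobian d T A 0)ᵀ *ᵥ G.outputJacobian d T A 0 *ᵥ (ε - ε₀)) ⬝ᵥ
        G.g d T A ε μ) ≤ -(2 * (c / b)) * G.lyapunov d T A (ε - ε₀) := by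
    intro ε hε
    have h1 := hdec ε ε₀ μ ((hsmall ε hε).trans_le (min_le_left _ _))
      (hε₀s.trans_le (min_le_left _ _)) (by linarith [min_le_left s₁ s₂]) hg
    have h2 : c / b * G.lyapunov d T A (ε - ε₀) ≤ c / b * (b * ‖ε - ε₀‖ ^ 2) := by
      gcongr
      exact (hab _).2
    have h3 : c / b * (b * ‖ε - ε₀‖ ^ 2) = c * ‖ε - ε₀‖ ^ 2 := by field_simp
    linarith
  have hinit : ∀ x₀ ∈ A, ‖err d (G.z x₀) - G.output d T A ε₀‖ < √(η / b) →
      G.lyapunov d T A (G.reducedErr d T x₀ - ε₀) < η := by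
    intro x₀ _ hx₀
    have h1 : ‖G.reducedErr d T x₀ - ε₀‖ ≤ ‖err d (G.z x₀) - G.output d T A ε₀‖ := by
      refine (pi_norm_le_iff_of_nonneg (norm_nonneg _)).2 fun k => ?_
      have h2 : (G.reducedErr d T x₀ - ε₀) k = (err d (G.z x₀) - G.output d T A ε₀) k := by
        rw [Pi.sub_apply, Pi.sub_apply, reducedErr_apply, output, Ptilde_transpose_mulVec_add,
          dif_pos k.2]
      rw [h2]
      exact norm_le_pi_norm _ _
    refine (hab _).2.trans_lt ?_
    have h3 := Real.lt_sqrt (norm_nonneg _) |>.1 (h1.trans_lt hx₀)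
    rwa [lt_div_iff₀ hb, mul_comm] at h3
  obtain ⟨h, K, L, hK, hL, hh⟩ :=
    exists_truncatedField G d μ (Lo * s + ‖G.output d T A ε₀‖)
  have hh' : ∀ x ∈ A, G.lyapunov d T A (G.reducedErr d T x - ε₀) < η →
      h x = G.overallField d μ x := by
    intro x hx hV
    refine hh x ?_
    rw [← hA.output_reducedErr hx]
    have h1 := hlip _ (hsmall _ hV)
    have h2 : ‖G.reducedErr d T x - ε₀‖ < s := by
      have := (hab (G.reducedErr d T x - ε₀)).1.trans_lt hV
      have := lt_of_pow_lt_pow_left₀ 2 (half_pos hs0).le (lt_of_mul_lt_mul_left this ha.le)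
      linarith
    have h3 := norm_add_le (G.output d T A (G.reducedErr d T x) - G.output d T A ε₀)
      (G.output d T A ε₀)
    rw [sub_add_cancel] at h3
    have h4 : (Lo : ℝ) * ‖G.reducedErr d T x - ε₀‖ ≤ Lo * s := by gcongr
    linarith
  have hρ : 0 ≤ 2 * (c / b) := by positivity
  have hsub : ∀ ε, G.lyapunov d T A (ε - ε₀) < η → ε ∈ G.reducedErr d T '' A := fun ε hε =>
    (hin ε (hsmall ε hε)).1
  -- `√(η / b)` comes from `V ≤ b‖·‖²`, and the `+ 1` keeps the constant positive if `Lo = 0`. As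
  -- `V` is quadratic, its rate `2c/b` halves to `c/b` for the error.
  refine ⟨√(η / b), Real.sqrt_pos.2 (by positivity), Lo * (s / 2) + 1, by positivity, c / b,
    by positivity, fun x₀ hx₀ hδ => ⟨?_, fun x hx => ?_⟩⟩
  · obtain ⟨x, hx0, hx⟩ := exists_forward_solution hK hL x₀
    have hstay := hA.forall_mem_and_lyapunov_le hn hρ hsub hdec' hh' hx (by rwa [hx0])
      (by rw [hx0]; exact hinit x₀ hx₀ hδ)
    refine ⟨x, hx0, fun t ht => ?_⟩
    rw [← hh' _ (hstay t ht).1.1 (hstay t ht).1.2]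
    exact hx t ht
  · obtain ⟨hx0, hx⟩ := hx
    have hV0 := hinit x₀ hx₀ hδ
    -- For an arbitrary trajectory the comparison field is the overall field itself; the truncation
    -- serves existence only.
    have hstay := hA.forall_mem_and_lyapunov_le hn hρ hsub hdec' (fun _ _ _ => rfl) hx
      (by rwa [hx0]) (by rwa [hx0])
    refine ⟨fun t ht => (hstay t ht).1.1, fun t ht => ?_⟩
    obtain ⟨⟨h1, h2⟩, h3⟩ := hstay t ht
    rw [hx0] at h3
    have h4 : ‖G.reducedErr d T (x t) - ε₀‖ ≤ s / 2 * Real.exp (-(c / b) * t) := by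
      have h5 := (hab (G.reducedErr d T (x t) - ε₀)).1.trans h3
      have h6 : Real.exp (-(2 * (c / b)) * t) = Real.exp (-(c / b) * t) ^ 2 := by
        rw [← Real.exp_nat_mul]
        congr 1
        push_cast
        ring
      have h7 : a * ‖G.reducedErr d T (x t) - ε₀‖ ^ 2 ≤
          a * (s / 2 * Real.exp (-(c / b) * t)) ^ 2 := by
        rw [h6] at h5
        refine h5.trans ?_
        rw [mul_pow, ← mul_assoc]
        gcongr
      exact le_of_sq_le_sq (le_of_mul_le_mul_left h7 ha) (by positivity)
    rw [← hA.output_reducedErr h1]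
    calc _ ≤ Lo * ‖G.reducedErr d T (x t) - ε₀‖ := hlip _ (hsmall _ h2)
      _ ≤ Lo * (s / 2 * Real.exp (-(c / b) * t)) := by gcongr
      _ = Lo * (s / 2) * Real.exp (-(c / b) * t) := by ring
      _ ≤ _ := by
          gcongr
          linarith

end OrientedGraph

end Formation

end

theorem theorem3 {n m : ℕ} (hn : 3 ≤ n) (G : Formation.OrientedGraph n m)
    (d : Fin m → ℝ) (y : Formation.MultiPoint n) (hy : G.IsTarget d y)
    (T : Finset (Fin m)) (hT : G.MinInfRigid T y) :
    (∃ A, G.IsAmbientSpace d T y A) ∧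
    ∀ A, G.IsAmbientSpace d T y A →
      (∃ M ε, G.IsEquilibriumBranch d T A M ε) ∧
      ∀ M₁ ε, G.IsEquilibriumBranch d T A M₁ ε →
        ∃ M₀ ∈ 𝓝 (0 : Fin m → ℝ), M₀ ⊆ M₁ ∧
          ∀ M ⊆ M₀, IsOpen M → 0 ∈ M → ∀ μ ∈ M,
            ∃ δ > 0, ∃ c > 0, ∃ r > 0, ∀ x₀ ∈ A,
              ‖Formation.err d (G.z x₀) - G.output d T A (ε μ)‖ < δ →
                (∃ x, G.IsTrajectory d μ x₀ x) ∧
                ∀ x, G.IsTrajectory d μ x₀ x →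
                  (∀ t, 0 ≤ t → x t ∈ A) ∧
                  ∀ t, 0 ≤ t →
                    ‖Formation.err d (G.z (x t)) - G.output d T A (ε μ)‖
                      ≤ c * Real.exp (-r * t) := by
  refine ⟨G.exists_isAmbientSpace hn hy hT, fun A hA =>
    ⟨hA.exists_isEquilibriumBranch hn hy, fun M₁ ε hε => ?_⟩⟩
  obtain ⟨s, hs, hconv⟩ := hA.exists_nhds_exponential_convergence hn hy
  have hM₁ : M₁ ∈ 𝓝 (0 : Fin m → ℝ) := hε.isOpen.mem_nhds hε.zero_mem
  have hcont : ContinuousAt ε 0 := (hε.smooth.contDiffAt hM₁).continuousAt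
  have hε0 : ∀ᶠ μ in 𝓝 (0 : Fin m → ℝ), ‖ε μ‖ < s := by
    have : Metric.ball (0 : {k // k ∈ T} → ℝ) s ∈ 𝓝 (ε 0) := by
      rw [hε.map_zero]
      exact Metric.ball_mem_nhds _ hs
    filter_upwards [hcont this] with μ hμ
    exact mem_ball_zero_iff.1 hμ
  -- One bound `s` controls both `μ` and `ε_μ`; the latter is small near `0` by continuity and `ε_0
  -- = 0`.
  refine ⟨M₁ ∩ ({μ | ‖ε μ‖ < s} ∩ Metric.ball 0 s),
    Filter.inter_mem hM₁ (Filter.inter_mem hε0 (Metric.ball_mem_nhds _ hs)),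
    Set.inter_subset_left, fun M hM _ _ μ hμ => ?_⟩
  obtain ⟨h1, h2, h3⟩ := hM hμ
  exact hconv μ (ε μ) (mem_ball_zero_iff.1 h3) h2 (hε.equilibrium μ h1)
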